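/- **Proposition 4.5.** *Notation (for $\overline{\mathfrak g}=sl(3)$, $n=3$).* Let $P\supset Q$ be the weight and root lattices of $sl(3)$, $\alpha_1,\alpha_2$ the simple roots, $\rho$ the half-sum of the positive roots, $\overline W\cong S_3$ the Weyl group, and $w\cdot\lambda=w(\lambda+\rho)-\rho$. Let $\tilde W=\overline W\ltimes t_P$ be the extended affine Weyl group, $W=\overline W\ltimes t_Q$ the affine Weyl group, and $y\mapsto\bar y$ the projection $\tilde W\to\overline W$. The group $\tilde W$ acts on affine real roots by $(\bar y\,t_{-\lambda})(\alpha+l\delta)=\bar y(\alpha)+(l+\langle\lambda,\alpha\rangle)\delta$. Let $A\subset\tilde W$ be the subgroup preserving the set $\{\alpha_0=\delta-\alpha_1-\alpha_2,\alpha_1,\alpha_2\}$ of affine simple roots, $\tilde{\mathcal W}^{(+)}$ the set of $y\in\tilde W$ such that $y(\alpha_1)$ and $y(\alpha_2)$ are positive affine real roots (the dominant chamber), and $\mathcal W^{(+)}=\tilde{\mathcal W}^{(+)}\cap W$, so that $\tilde{\mathcal W}^{(+)}=\bigcup_{a\in A}a\,\mathcal W^{(+)}$. For $z\in\tilde{\mathcal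 W}^{(+)}$ let $\overline W^{[z]}$ be the horizontal Kac–Wakimoto group, generated by the reflections in $z(\alpha_1)$ and $z(\alpha_2)$. Put $\iota(\bar y\,t_{-\lambda})=3\lambda+\bar y^{-1}\cdot 0$. Let $K$ be the Kostant partition function of $sl(3)$, and $\overline m^{\lambda}_{\mu}=\sum_{w\in\overline W}\det(w)\,K_{w\cdot\lambda-\mu}$ for weights $\lambda,\mu$. For $y,z\in\tilde W$ put $K^y_z=K_{\iota(y)-\iota(z)}$ if $zy^{-1}\in W$ and $K^y_z=0$ otherwise, and $$m^y_z=\sum_{w\in\overline W}\det(w)\,K^{yw}_z,\qquad \chi_y=\sum_{z\in\tilde W}m^y_z\,z .$$ *Claim.* For every $y\in\tilde W$ only finitely many $m^y_z$ are nonzero, so that $\chi_y\in\mathbb Z[\tilde W]$. The characters $\chi_y$, $y\in\tilde{\mathcal W}^{(+)}$, are linearly independent over $\mathbb Z$; the subring of $\mathbb Z[\tilde W]$ that they generate is commutative and is equal to their $\mathbb Z$-span. For all $x,y\in\tilde{\mathcal W}^{(+)}$, $$\chi_x\,\chi_y=\sum_{z\in\tilde W}m^x_z\,\chi_{zy}.$$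 There are integers $N^z_{x,y}$ such that, for $a,a'\in A$, $x\in a\,\mathcal W^{(+)}$ and $y\in a'\,\mathcal W^{(+)}$, only finitely many $N^z_{x,y}$ with $z\in aa'\,\mathcal W^{(+)}$ are nonzero, $$\chi_x\,\chi_y=\sum_{z\in aa'\mathcal W^{(+)}}N^z_{x,y}\,\chi_z ,$$ and for every $z\in aa'\,\mathcal W^{(+)}$ the group $\overline W^{[z]}$ is finite and $$N^z_{x,y}=\sum_{w'\in\overline W^{[z]}}\det(\overline{w'})\,m^x_{w'zy^{-1}}=\sum_{w\in\overline W}\det(w)\,m^x_{zwy^{-1}}=\sum_{w\in\overline W}\det(w)\,\overline m^{\iota(x)}_{\iota(zwy^{-1})}.$$ -/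

import Mathlib

open scoped BigOperators

namespace CharRing

noncomputable section

/-! ### Weights, roots and the horizontal Weyl group of `sl(n)`

The dual of the Cartan subalgebra is realised by vectors of coordinate sum zero, with the usual dot
product as invariant form, roots `e_i - e_j`, and the Weyl group `S_n` permuting the coordinates.
Indices run over `0, ..., n - 1`. -/

/-- The horizontal Weyl group; `det w` is the sign of the permutation `w`. -/
abbrev Weyl (n : ℕ) : Type := Equiv.Perm (Fin n)

/-- The determinant of a Weyl group element, as an integer. -/
def det {n : ℕ} (w : Weyl n) : ℤ := (Equiv.Perm.sign w : ℤ)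

/-- Linear action of the Weyl group: `w (e_i) = e_(w i)`. -/
def act {n : ℕ} (w : Weyl n) (v : Fin n → ℚ) : Fin n → ℚ := fun i => v (w⁻¹ i)

theorem act_one {n : ℕ} (v : Fin n → ℚ) : act 1 v = v := rfl

theorem act_mul {n : ℕ} (u w : Weyl n) (v : Fin n → ℚ) : act (u * w) v = act u (act w v) := rfl

theorem act_add {n : ℕ} (w : Weyl n) (v v' : Fin n → ℚ) : act w (v + v') = act w v + act w v' := rfl

/-- The root `e_i - e_j` (`i ≠ j`); it is positive when `i < j` and simple when `j = i + 1`. -/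
def root {n : ℕ} (i j : Fin n) : Fin n → ℚ := Pi.single i 1 - Pi.single j 1

theorem act_root {n : ℕ} (w : Weyl n) (i j : Fin n) : act w (root i j) = root (w i) (w j) := by
  funext k
  have h : ∀ i, w⁻¹ k = i ↔ k = w i := fun i => Equiv.Perm.inv_eq_iff_eq
  simp only [act, root, Pi.sub_apply, Pi.single_apply, h]

/-- The Weyl vector: half the sum of the positive roots. -/
def rho (n : ℕ) : Fin n → ℚ :=
  (1 / 2 : ℚ) • ∑ p : {p : Fin n × Fin n // p.1 < p.2}, root p.1.1 p.1.2

/-- The shifted action `w · v = w (v + ρ) - ρ`. -/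
def dotAct {n : ℕ} (w : Weyl n) (v : Fin n → ℚ) : Fin n → ℚ := act w (v + rho n) - rho n

/-- The weight lattice `P`: the weights whose pairing with every root is an integer. -/
def weightLattice (n : ℕ) : AddSubgroup (Fin n → ℚ) where
  carrier := {v | ∑ i, v i = 0 ∧ ∀ i j, ∃ k : ℤ, v i - v j = k}
  zero_mem' := ⟨by simp, fun _ _ => ⟨0, by simp⟩⟩
  add_mem' := by
    rintro v v' ⟨h, hk⟩ ⟨h', hk'⟩
    refine ⟨by simp [Finset.sum_add_distrib, h, h'], fun i j => ?_⟩
    obtain ⟨k, e⟩ := hk i j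
    obtain ⟨k', e'⟩ := hk' i j
    exact ⟨k + k', by push_cast; rw [← e, ← e']; simp only [Pi.add_apply]; ring⟩
  neg_mem' := by
    rintro v ⟨h, hk⟩
    refine ⟨by simp [h], fun i j => ?_⟩
    obtain ⟨k, e⟩ := hk i j
    exact ⟨-k, by push_cast; rw [← e]; simp only [Pi.neg_apply]; ring⟩

/-- The root lattice `Q`. -/
def rootLattice (n : ℕ) : AddSubgroup (Fin n → ℚ) :=
  AddSubgroup.closure {v | ∃ i j : Fin n, v = root i j}

theorem act_mem_weightLattice {n : ℕ} (w : Weyl n) {v : Fin n → ℚ} (hv : v ∈ weightLattice n) :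
    act w v ∈ weightLattice n :=
  ⟨by rw [← hv.1]; exact Equiv.sum_comp (w⁻¹ : Equiv.Perm (Fin n)) v,
    fun i j => hv.2 (w⁻¹ i) (w⁻¹ j)⟩

theorem act_mem_rootLattice {n : ℕ} (w : Weyl n) {v : Fin n → ℚ} (hv : v ∈ rootLattice n) :
    act w v ∈ rootLattice n := by
  induction hv using AddSubgroup.closure_induction with
  | mem v h =>
    obtain ⟨i, j, rfl⟩ := h
    exact AddSubgroup.subset_closure ⟨w i, w j, act_root w i j⟩
  | zero => exact (rootLattice n).zero_mem
  | add v v' _ _ h h' => exact (rootLattice n).add_mem h h'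
  | neg v _ h => exact (rootLattice n).neg_mem h

theorem root_mem_weightLattice {n : ℕ} (i j : Fin n) : root i j ∈ weightLattice n := by
  refine ⟨by simp [root], fun k l => ?_⟩
  refine ⟨(Pi.single i 1 - Pi.single j 1 : Fin n → ℤ) k
    - (Pi.single i 1 - Pi.single j 1 : Fin n → ℤ) l, ?_⟩
  simp [root, Pi.single_apply]

/-- The Weyl group acting on the weight lattice, written multiplicatively. -/
def latticeAct (n : ℕ) : Weyl n →* MulAut (Multiplicative (weightLattice n)) where
  toFun w :=
    { toFun := fun v => Multiplicative.ofAdd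
        ⟨act w (v.toAdd : weightLattice n), act_mem_weightLattice w v.toAdd.2⟩
      invFun := fun v => Multiplicative.ofAdd
        ⟨act w⁻¹ (v.toAdd : weightLattice n), act_mem_weightLattice w⁻¹ v.toAdd.2⟩
      left_inv := fun v => Multiplicative.toAdd.injective <| Subtype.ext <| by
        simp [← act_mul, act_one]
      right_inv := fun v => Multiplicative.toAdd.injective <| Subtype.ext <| by
        simp [← act_mul, act_one]
      map_mul' := fun _ _ => rfl }
  map_one' := rfl
  map_mul' _ _ := rfl

/-! ### The extended affine Weyl group -/

/-- The extended affine Weyl group: the semidirect product of the translations by the weight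
lattice and the Weyl group. The pair `⟨β, w⟩` is `t_β w = w t_(w⁻¹ β)`. -/
abbrev ExtAffWeyl (n : ℕ) : Type := Multiplicative (weightLattice n) ⋊[latticeAct n] Weyl n

/-- The Weyl group as a subgroup of the extended affine Weyl group. -/
def ofWeyl {n : ℕ} (w : Weyl n) : ExtAffWeyl n := SemidirectProduct.inr w

/-- The translation `t_β` by a weight. -/
def transl {n : ℕ} (β : weightLattice n) : ExtAffWeyl n :=
  SemidirectProduct.inl (Multiplicative.ofAdd β)

/-- The vector `β` of `y = t_β w`. -/
def shift {n : ℕ} (y : ExtAffWeyl n) : Fin n → ℚ := (y.left.toAdd : weightLattice n)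

/-- The affine Weyl group: the elements whose translation part lies in the root lattice. -/
def affWeyl (n : ℕ) : Subgroup (ExtAffWeyl n) where
  carrier := {y | shift y ∈ rootLattice n}
  one_mem' := (rootLattice n).zero_mem
  mul_mem' := fun {x _} hx hy => (rootLattice n).add_mem hx (act_mem_rootLattice x.right hy)
  inv_mem' := fun {x} hx => act_mem_rootLattice x.right⁻¹ ((rootLattice n).neg_mem hx)

/-- The action on level zero weights: the pair `(v, l)` stands for `v + l δ`, and
`t_β w (v + l δ) = w v + (l - ⟨w v, β⟩) δ`. -/
def affAct {n : ℕ} (y : ExtAffWeyl n) (r : (Fin n → ℚ) × ℚ) : (Fin n → ℚ) × ℚ :=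
  (act y.right r.1, r.2 - act y.right r.1 ⬝ᵥ shift y)

theorem affAct_one {n : ℕ} (r : (Fin n → ℚ) × ℚ) : affAct 1 r = r := by
  ext
  · rfl
  · change r.2 - act 1 r.1 ⬝ᵥ (0 : Fin n → ℚ) = r.2
    simp

theorem affAct_mul {n : ℕ} (x y : ExtAffWeyl n) (r : (Fin n → ℚ) × ℚ) :
    affAct (x * y) r = affAct x (affAct y r) := by
  ext
  · rfl
  · have h : act x.right (act y.right r.1) ⬝ᵥ act x.right (shift y)
        = act y.right r.1 ⬝ᵥ shift y :=
      Equiv.sum_comp (x.right⁻¹ : Equiv.Perm (Fin n)) fun i => act y.right r.1 i * shift y i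
    change r.2 - act x.right (act y.right r.1) ⬝ᵥ (shift x + act x.right (shift y))
      = r.2 - act y.right r.1 ⬝ᵥ shift y - act x.right (act y.right r.1) ⬝ᵥ shift x
    rw [dotProduct_add, h]
    ring

/-- Positive real roots of the affine algebra: `α + l δ` with `l > 0`, or `l = 0` and `α > 0`. -/
def IsPosRealRoot {n : ℕ} (r : (Fin n → ℚ) × ℚ) : Prop :=
  ∃ (i j : Fin n) (l : ℤ), i ≠ j ∧ r = (root i j, (l : ℚ)) ∧ (0 < l ∨ (l = 0 ∧ i < j))

/-- The simple roots of the affine algebra: those of `sl(n)`, and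
`α_0 = δ - (e_0 - e_(n-1))`. -/
def affSimpleRoots (n : ℕ) : Set ((Fin n → ℚ) × ℚ) :=
  {r | (∃ i j : Fin n, (i : ℕ) + 1 = j ∧ r = (root i j, 0)) ∨
    ∃ i j : Fin n, (i : ℕ) = 0 ∧ (j : ℕ) + 1 = n ∧ r = (root j i, 1)}

/-- The subgroup `A` of the elements that keep the set of affine simple roots invariant. -/
def diagramGroup (n : ℕ) : Subgroup (ExtAffWeyl n) where
  carrier := {a | affAct a '' affSimpleRoots n = affSimpleRoots n}
  one_mem' := by
    have h : affAct (1 : ExtAffWeyl n) = id := funext affAct_one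
    simp [h]
  mul_mem' := by
    intro a b (ha : affAct a '' _ = _) (hb : affAct b '' _ = _)
    have h : affAct (a * b) = affAct a ∘ affAct b := funext (affAct_mul a b)
    change affAct (a * b) '' _ = _
    rw [h, Set.image_comp, hb, ha]
  inv_mem' := by
    intro a (ha : affAct a '' _ = _)
    have h : affAct a⁻¹ ∘ affAct a = id := funext fun r => by
      rw [Function.comp_apply, ← affAct_mul, inv_mul_cancel, affAct_one, id]
    change affAct a⁻¹ '' _ = _
    conv_lhs => rw [← ha]
    rw [← Set.image_comp, h, Set.image_id]

/-- The dominant chamber of the extended affine Weyl group: the elements that send every simple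
root of `sl(n)` to a positive real root of the affine algebra. -/
def extChamber (n : ℕ) : Set (ExtAffWeyl n) :=
  {y | ∀ i j : Fin n, (i : ℕ) + 1 = j → IsPosRealRoot (affAct y (root i j, 0))}

/-- The dominant chamber of the affine Weyl group. -/
def chamber (n : ℕ) : Set (ExtAffWeyl n) := extChamber n ∩ affWeyl n

/-- The translate `a C` of the chamber `C` of the affine Weyl group. -/
def chamberAt {n : ℕ} (a : ExtAffWeyl n) : Set (ExtAffWeyl n) := (fun c => a * c) '' chamber n

/-- The reflection with respect to the real root `e_i - e_j + l δ`, `w_(α + l δ) = t_(-l α) w_α`. -/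
def affReflection {n : ℕ} (i j : Fin n) (l : ℤ) : ExtAffWeyl n :=
  transl (-(l • ⟨root i j, root_mem_weightLattice i j⟩)) * ofWeyl (Equiv.swap i j)

/-- The horizontal Kac–Wakimoto group attached to `z`, generated by the reflections with respect
to the images under `z` of the simple roots of `sl(n)`. -/
def kwGroup {n : ℕ} (z : ExtAffWeyl n) : Subgroup (ExtAffWeyl n) :=
  Subgroup.closure {r | ∃ p q : Fin n, (p : ℕ) + 1 = q ∧ ∃ (i j : Fin n) (l : ℤ),
    affAct z (root p q, 0) = (root i j, (l : ℚ)) ∧ r = affReflection i j l}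

/-! ### Multiplicities and characters -/

/-- The Kostant partition function of `sl(n)`: the number of ways to write a weight as a
combination of the positive roots with coefficients in `ℕ`. -/
def kostant {n : ℕ} (β : Fin n → ℚ) : ℕ :=
  Nat.card {k : {p : Fin n × Fin n // p.1 < p.2} → ℕ // ∑ p, k p • root p.1.1 p.1.2 = β}

/-- The multiplicity `m̄^λ_μ = ∑_w det(w) K_(w·λ - μ)` of `sl(n)`. -/
def weightMult {n : ℕ} (lam mu : Fin n → ℚ) : ℤ :=
  ∑ w : Weyl n, det w * (kostant (dotAct w lam - mu) : ℤ)

/-- The map `ι : w t_(-λ) ↦ n λ + w⁻¹ · 0`; for `y = t_β w` one has `λ = - w⁻¹ β`. -/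
def iota {n : ℕ} (y : ExtAffWeyl n) : Fin n → ℚ :=
  (n : ℚ) • (-(act y.right⁻¹ (shift y))) + dotAct y.right⁻¹ 0

open Classical in
/-- The multiplicity `K^y_z` of `z` in the generalised Verma module `V_y`; its formal character is
the series `∑_z K^y_z z`. -/
def vermaMult {n : ℕ} (y z : ExtAffWeyl n) : ℤ :=
  if z * y⁻¹ ∈ affWeyl n then (kostant (iota y - iota z) : ℤ) else 0

/-- The multiplicity `m^y_z = ∑_w det(w) K^(y w)_z`: the coefficient of `z` in the alternating sum
`∑_w det(w) ch V_(y w)` of formal series. -/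
def charMult {n : ℕ} (y z : ExtAffWeyl n) : ℤ :=
  ∑ w : Weyl n, det w * vermaMult (y * ofWeyl w) z

/-- The character `χ_y = ∑_z m^y_z z`, an element of the group ring. -/
def chi {n : ℕ} (y : ExtAffWeyl n) : MonoidAlgebra ℤ (ExtAffWeyl n) :=
  ∑ᶠ z : ExtAffWeyl n, MonoidAlgebra.single z (charMult y z)

/-- The resolution formula, used outside of the chamber as well, agrees with the extension of the
characters by the rule `χ_(y w) = det(w) χ_y`. -/
theorem charMult_mul_ofWeyl {n : ℕ} (y z : ExtAffWeyl n) (w : Weyl n) :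
    charMult (y * ofWeyl w) z = det w * charMult y z := by
  unfold charMult
  rw [Finset.mul_sum, ← Equiv.sum_comp (Equiv.mulLeft w)
    fun u => det w * (det u * vermaMult (y * ofWeyl u) z)]
  refine Finset.sum_congr rfl fun u _ => ?_
  have h : det w * det w = 1 := by
    simp [det, ← Units.val_mul]
  have h' : det (w * u) = det w * det u := by simp [det]
  have h'' : ofWeyl (w * u) = ofWeyl w * ofWeyl u := map_mul SemidirectProduct.inr w u
  simp only [Equiv.coe_mulLeft, h', h'', mul_assoc]
  rw [← mul_assoc (det w) (det w), h, one_mul]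

end

end CharRing

open CharRing

/-!
# The characters `χ_y` of the extended affine Weyl group of `sl(3)`

Everything is read off in the group ring `ℤ[Q]` of the root lattice through `ι`. The map `ι` is a
cocycle, `ι(x y) = ȳ⁻¹ ι(x) + ι(y)` (`iotaCoord_mul`), and on each coset of the affine Weyl group it
is a bijection onto the elements of `Q` whose class in `Q / 3 P ≅ ℤ / 3` is `0` or `1`: the classes
`0` and `1` are the images of the elements with even and odd Weyl group part, and the class `2` is
omitted (`eq_of_iotaCoord_eq`, `exists_iotaCoord_eq`). So an element of the group ring supported on
one coset is determined by its image in `ℤ[Q]`. The image of `χ_y` is `F₀ + F₁`, where `F₀, F₁, F₂`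
are the components of the Weyl character `F` of highest weight `ι(y)` with respect to the
grading of `ℤ[Q]` by `Q / 3 P` (`iotaLin_chi`). As `F` is invariant under the Weyl group, and
reflections exchange the classes `1` and `2`, the cocycle property turns left multiplication by
`χ_y` into multiplication by `F₀ + F₁` on the class `0` and by `F₀ + F₂` on the class `1`
(`iotaLin_chi_mul`).

The one fact about `sl(3)` behind the claims is that no `ι(y) + ρ` has class `0`. The Weyl numerator
of `F` then has no component of class `0`. The denominator is `D = D₁ + D₂`, and the Weyl character
formula `D F = A` splits into `D₁ F₂ + D₂ F₁ = 0`, `D₁ F₀ + D₂ F₂ = A₁`, `D₁ F₁ + D₂ F₀ = A₂`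
(`comp_alt_rho_mul`). The first equation says that `F₁ / F₂` is the same for all `y`. This gives
commutativity (`chi_mul_comm`); with the other two, and since `ℤ[Q]` is a domain, it identifies the
product `χ_x χ_y` with `∑_z m^x_z χ_(z y)`, because both have the same numerator
(`comp_add_comp_of_numerator`, `chi_mul_chi`).

The same fact says that no `ι(y) + ρ` lies on a wall, so that the extended affine Weyl group is the
disjoint union of the translates of the chamber by the Weyl group acting on the right
(`chamberEquiv`). Collecting the terms of the product accordingly, with `χ_(z w) = det(w) χ_z`,
gives the structure constants. Linear independence is the triangularity of the weight diagrams, and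
the horizontal Kac–Wakimoto group of `z` is the conjugate of the Weyl group by `z` (`coe_kwGroup`).
-/

namespace CharRing

noncomputable section

/-! ### The root lattice in coordinates -/

/-- The integral vector `(a, b - a, -b)` of the element `a α₁ + b α₂` of the root lattice. -/
def rootVec : ℤ × ℤ →+ (Fin 3 → ℤ) where
  toFun v := ![v.1, v.2 - v.1, -v.2]
  map_zero' := by ext i; fin_cases i <;> simp
  map_add' u v := by ext i; fin_cases i <;> simp <;> ring

theorem sum_rootVec (v : ℤ × ℤ) : ∑ i, rootVec v i = 0 := by
  simp [rootVec, Fin.sum_univ_three]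

theorem rootVec_injective : Function.Injective rootVec := by
  intro u v h
  have h0 := congrFun h 0
  have h2 := congrFun h 2
  simp only [rootVec, AddMonoidHom.coe_mk, ZeroHom.coe_mk, Matrix.cons_val] at h0 h2
  ext <;> lia

/-- The Weyl group acting on the coordinates of the root lattice. -/
def coordAct (w : Weyl 3) : ℤ × ℤ →+ ℤ × ℤ where
  toFun v := (rootVec v (w⁻¹ 0), -rootVec v (w⁻¹ 2))
  map_zero' := by simp
  map_add' u v := by ext <;> simp [add_comm]

theorem rootVec_coordAct (w : Weyl 3) (v : ℤ × ℤ) (i : Fin 3) :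
    rootVec (coordAct w v) i = rootVec v (w⁻¹ i) := by
  have h := (Equiv.sum_comp w⁻¹ (rootVec v)).trans (sum_rootVec v)
  rw [Fin.sum_univ_three] at h
  fin_cases i <;> simp [coordAct]
  · simp [rootVec]
  · have : rootVec (rootVec v (w⁻¹ 0), -rootVec v (w⁻¹ 2)) 1
      = -rootVec v (w⁻¹ 2) - rootVec v (w⁻¹ 0) := by simp [rootVec]
    change rootVec (rootVec v (w⁻¹ 0), -rootVec v (w⁻¹ 2)) 1 = rootVec v (w⁻¹ 1)
    linarith
  · simp [rootVec]

theorem coordAct_one (v : ℤ × ℤ) : coordAct 1 v = v :=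
  rootVec_injective <| funext fun i => by rw [rootVec_coordAct]; rfl

theorem coordAct_mul (u w : Weyl 3) (v : ℤ × ℤ) :
    coordAct (u * w) v = coordAct u (coordAct w v) :=
  rootVec_injective <| funext fun i => by simp only [rootVec_coordAct, mul_inv_rev]; rfl

theorem coordAct_inv_self (w : Weyl 3) (v : ℤ × ℤ) : coordAct w⁻¹ (coordAct w v) = v := by
  rw [← coordAct_mul, inv_mul_cancel, coordAct_one]

theorem coordAct_self_inv (w : Weyl 3) (v : ℤ × ℤ) : coordAct w (coordAct w⁻¹ v) = v := by
  rw [← coordAct_mul, mul_inv_cancel, coordAct_one]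

theorem det_eq (w : Weyl 3) : det w = 1 ∨ det w = -1 := by
  rcases Int.units_eq_one_or (Equiv.Perm.sign w) with h | h <;> simp [det, h]

theorem det_mul (u w : Weyl 3) : det (u * w) = det u * det w := by simp [det]

theorem det_inv (w : Weyl 3) : det w⁻¹ = det w := by simp [det]

theorem det_mul_self (w : Weyl 3) : det w * det w = 1 := by
  rcases det_eq w with h | h <;> simp [h]

/-- The elements of the Weyl group, with their determinants, as maps of the coordinates. -/
theorem coordAct_cases (w : Weyl 3) :
    (det w = 1 ∧ ∀ a b, coordAct w (a, b) = (a, b)) ∨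
    (det w = 1 ∧ ∀ a b, coordAct w (a, b) = (b - a, -a)) ∨
    (det w = 1 ∧ ∀ a b, coordAct w (a, b) = (-b, a - b)) ∨
    (det w = -1 ∧ ∀ a b, coordAct w (a, b) = (b - a, b)) ∨
    (det w = -1 ∧ ∀ a b, coordAct w (a, b) = (a, a - b)) ∨
    (det w = -1 ∧ ∀ a b, coordAct w (a, b) = (-b, -a)) := by
  have key : ∀ w : Weyl 3, (det w = 1 ∧ w⁻¹ 0 = 0 ∧ w⁻¹ 2 = 2) ∨
    (det w = 1 ∧ w⁻¹ 0 = 1 ∧ w⁻¹ 2 = 0) ∨ (det w = 1 ∧ w⁻¹ 0 = 2 ∧ w⁻¹ 2 = 1) ∨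
    (det w = -1 ∧ w⁻¹ 0 = 1 ∧ w⁻¹ 2 = 2) ∨ (det w = -1 ∧ w⁻¹ 0 = 0 ∧ w⁻¹ 2 = 1) ∨
    (det w = -1 ∧ w⁻¹ 0 = 2 ∧ w⁻¹ 2 = 0) := by decide
  rcases key w with ⟨h, h0, h2⟩ | ⟨h, h0, h2⟩ | ⟨h, h0, h2⟩ | ⟨h, h0, h2⟩ |
    ⟨h, h0, h2⟩ | ⟨h, h0, h2⟩
  · exact Or.inl ⟨h, fun a b => by simp [coordAct, h0, h2, rootVec]⟩
  · exact Or.inr (Or.inl ⟨h, fun a b => by simp [coordAct, h0, h2, rootVec]⟩)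
  · exact Or.inr (Or.inr (Or.inl ⟨h, fun a b => by simp [coordAct, h0, h2, rootVec]⟩))
  · exact Or.inr (Or.inr (Or.inr (Or.inl ⟨h, fun a b => by simp [coordAct, h0, h2, rootVec]⟩)))
  · exact Or.inr (Or.inr (Or.inr (Or.inr (Or.inl
      ⟨h, fun a b => by simp [coordAct, h0, h2, rootVec]⟩))))
  · exact Or.inr (Or.inr (Or.inr (Or.inr (Or.inr
      ⟨h, fun a b => by simp [coordAct, h0, h2, rootVec]⟩))))

theorem weyl_univ : (Finset.univ : Finset (Weyl 3)) =
    {1, Equiv.swap 0 1 * Equiv.swap 1 2, Equiv.swap 1 2 * Equiv.swap 0 1,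
      Equiv.swap 0 1, Equiv.swap 1 2, Equiv.swap 0 2} := by decide

theorem weyl_induction {p : Weyl 3 → Prop} (one : p 1) (s₁ : p (Equiv.swap 0 1))
    (s₂ : p (Equiv.swap 1 2)) (mul : ∀ u w, p u → p w → p (u * w)) (w : Weyl 3) : p w := by
  have h : ∀ w : Weyl 3, w = 1 ∨ w = Equiv.swap 0 1 * Equiv.swap 1 2 ∨
      w = Equiv.swap 1 2 * Equiv.swap 0 1 ∨ w = Equiv.swap 0 1 ∨ w = Equiv.swap 1 2 ∨
      w = Equiv.swap 0 1 * Equiv.swap 1 2 * Equiv.swap 0 1 := by decide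
  rcases h w with rfl | rfl | rfl | rfl | rfl | rfl
  exacts [one, mul _ _ s₁ s₂, mul _ _ s₂ s₁, s₁, s₂, mul _ _ (mul _ _ s₁ s₂) s₁]

theorem coordAct_swap₁ (a b : ℤ) : coordAct (Equiv.swap 0 1) (a, b) = (b - a, b) := by
  have h2 : (Equiv.swap 0 1 : Weyl 3)⁻¹ 2 = 2 := by decide
  have h0 : (Equiv.swap 0 1 : Weyl 3)⁻¹ 0 = 1 := by decide
  simp only [coordAct, AddMonoidHom.coe_mk, ZeroHom.coe_mk, h0, h2]
  simp [rootVec]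

theorem coordAct_swap₂ (a b : ℤ) : coordAct (Equiv.swap 1 2) (a, b) = (a, a - b) := by
  have h2 : (Equiv.swap 1 2 : Weyl 3)⁻¹ 2 = 1 := by decide
  have h0 : (Equiv.swap 1 2 : Weyl 3)⁻¹ 0 = 0 := by decide
  simp only [coordAct, AddMonoidHom.coe_mk, ZeroHom.coe_mk, h0, h2]
  simp [rootVec]

/-- Alternating sums over an orbit of the Weyl group, written out. -/
theorem sum_det_mul_coordAct (g : ℤ × ℤ → ℤ) (a b : ℤ) :
    ∑ w : Weyl 3, det w * g (coordAct w (a, b)) = g (a, b) + g (b - a, -a) + g (-b, a - b)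
      - g (b - a, b) - g (a, a - b) - g (-b, -a) := by
  have h02 : coordAct (Equiv.swap 0 2) (a, b) = (-b, -a) := by
    rw [show (Equiv.swap 0 2 : Weyl 3) = Equiv.swap 0 1 * Equiv.swap 1 2 * Equiv.swap 0 1 by decide,
      coordAct_mul, coordAct_mul, coordAct_swap₁, coordAct_swap₂, coordAct_swap₁]
    ext
    · simp only; ring
    · simp only; ring
  have hd (i j : Fin 3) (h : i ≠ j) : det (Equiv.swap i j) = -1 := by
    simp [det, Equiv.Perm.sign_swap h]
  rw [weyl_univ, Finset.sum_insert (by decide), Finset.sum_insert (by decide),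
    Finset.sum_insert (by decide), Finset.sum_insert (by decide), Finset.sum_insert (by decide),
    Finset.sum_singleton, h02]
  simp only [det_mul, hd 0 1 (by decide), hd 1 2 (by decide), hd 0 2 (by decide), coordAct_mul,
    coordAct_swap₁, coordAct_swap₂, coordAct_one, show det (1 : Weyl 3) = 1 by simp [det]]
  simp
  ring

/-- The class of a root lattice element modulo `3 P`, as an element of `Q / 3 P ≅ ℤ / 3`. The sign
is chosen so that `ρ` and the values of `ι` at the reflections have class `1`. -/
def cls : ℤ × ℤ →+ ZMod 3 where
  toFun v := -((v.1 + v.2 : ℤ) : ZMod 3)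
  map_zero' := by simp
  map_add' u v := by push_cast [Prod.fst_add, Prod.snd_add]; ring

/-- The Weyl group acts on `Q / 3 P` through the determinant. -/
theorem cls_coordAct (w : Weyl 3) (v : ℤ × ℤ) :
    cls (coordAct w v) = (det w : ZMod 3) * cls v := by
  have h3 : (3 : ZMod 3) = 0 := by decide
  obtain ⟨a, b⟩ := v
  rcases coordAct_cases w with ⟨h, e⟩ | ⟨h, e⟩ | ⟨h, e⟩ | ⟨h, e⟩ | ⟨h, e⟩ | ⟨h, e⟩ <;>
    simp only [e, h, cls, AddMonoidHom.coe_mk, ZeroHom.coe_mk] <;> push_cast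
  · ring
  · linear_combination (a : ZMod 3) * h3
  · linear_combination (b : ZMod 3) * h3
  · linear_combination -(b : ZMod 3) * h3
  · linear_combination -(a : ZMod 3) * h3
  · ring

/-! ### The Kostant partition function -/

/-- The Kostant partition function of `sl(3)` in closed form: `a α₁ + b α₂` is a sum of
`c` copies of `α₁ + α₂`, `a - c` copies of `α₁` and `b - c` copies of `α₂`, with
`0 ≤ c ≤ min a b`. -/
def kp (v : ℤ × ℤ) : ℤ := if 0 ≤ v.1 ∧ 0 ≤ v.2 then min v.1 v.2 + 1 else 0

theorem root_zero_one : (root 0 1 : Fin 3 → ℚ) = ![1, -1, 0] := by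
  ext i; fin_cases i <;> simp [root]

theorem root_zero_two : (root 0 2 : Fin 3 → ℚ) = ![1, 0, -1] := by
  ext i; fin_cases i <;> simp [root]

theorem root_one_two : (root 1 2 : Fin 3 → ℚ) = ![0, 1, -1] := by
  ext i; fin_cases i <;> simp [root]

theorem kostant_rootVec (v : ℤ × ℤ) :
    (kostant (fun i => ((rootVec v i : ℤ) : ℚ)) : ℤ) = kp v := by
  obtain ⟨a, b⟩ := v
  have hsum : ∀ k : {p : Fin 3 × Fin 3 // p.1 < p.2} → ℕ,
      ∑ p, k p • (root p.1.1 p.1.2 : Fin 3 → ℚ) = k ⟨(0, 1), by decide⟩ • root 0 1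
        + k ⟨(0, 2), by decide⟩ • root 0 2 + k ⟨(1, 2), by decide⟩ • root 1 2 := by
    intro k
    have hu : (Finset.univ : Finset {p : Fin 3 × Fin 3 // p.1 < p.2}) =
      {⟨(0, 1), by decide⟩, ⟨(0, 2), by decide⟩, ⟨(1, 2), by decide⟩} := by decide
    rw [hu, Finset.sum_insert (by decide), Finset.sum_insert (by decide), Finset.sum_singleton,
      add_assoc]
  have hiff : ∀ k : {p : Fin 3 × Fin 3 // p.1 < p.2} → ℕ,
      (∑ p, k p • (root p.1.1 p.1.2 : Fin 3 → ℚ) = fun i => ((rootVec (a, b) i : ℤ) : ℚ)) ↔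
        (k ⟨(0, 1), by decide⟩ + k ⟨(0, 2), by decide⟩ : ℤ) = a ∧
        (k ⟨(1, 2), by decide⟩ + k ⟨(0, 2), by decide⟩ : ℤ) = b := by
    intro k
    rw [hsum, root_zero_one, root_zero_two, root_one_two, funext_iff, Fin.forall_fin_succ,
      Fin.forall_fin_two]
    simp [rootVec]
    constructor
    · rintro ⟨h0, -, h2⟩
      constructor
      · exact_mod_cast h0
      · have : ((k ⟨(1, 2), by decide⟩ : ℚ) + k ⟨(0, 2), by decide⟩) = b := by linarith
        exact_mod_cast this
    · rintro ⟨h0, h2⟩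
      have h0' : ((k ⟨(0, 1), by decide⟩ : ℚ) + k ⟨(0, 2), by decide⟩) = a := by exact_mod_cast h0
      have h2' : ((k ⟨(1, 2), by decide⟩ : ℚ) + k ⟨(0, 2), by decide⟩) = b := by exact_mod_cast h2
      refine ⟨by linarith, by linarith, by linarith⟩
  unfold kostant kp
  have e : {k : {p : Fin 3 × Fin 3 // p.1 < p.2} → ℕ //
      ∑ p, k p • (root p.1.1 p.1.2 : Fin 3 → ℚ) = fun i => ((rootVec (a, b) i : ℤ) : ℚ)} ≃
      {c : ℕ // (c : ℤ) ≤ a ∧ (c : ℤ) ≤ b} :=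
    { toFun := fun k => ⟨k.1 ⟨(0, 2), by decide⟩, by
        have := (hiff k.1).1 k.2; lia⟩
      invFun := fun c => ⟨fun p => if p.1 = (0, 2) then c.1 else
          if p.1 = (0, 1) then (a - c.1).toNat else (b - c.1).toNat, by
        rw [hiff]
        have := c.2
        simp
        lia⟩
      left_inv := by
        rintro ⟨k, hk⟩
        have h := (hiff k).1 hk
        ext ⟨⟨i, j⟩, hij⟩
        fin_cases i <;> fin_cases j <;> simp at hij ⊢ <;> lia
      right_inv := by
        rintro ⟨c, hc⟩
        simp }
  rw [Nat.card_congr e]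
  by_cases h : 0 ≤ a ∧ 0 ≤ b
  · have : Nat.card {c : ℕ // (c : ℤ) ≤ a ∧ (c : ℤ) ≤ b} = (min a b + 1).toNat := by
      have e' : {c : ℕ | (c : ℤ) ≤ a ∧ (c : ℤ) ≤ b} = Finset.range (min a b + 1).toNat := by
        ext c
        simp only [Set.mem_ofPred_eq, Finset.coe_range, Set.mem_Iio]
        lia
      have := Nat.card_coe_set_eq {c : ℕ | (c : ℤ) ≤ a ∧ (c : ℤ) ≤ b}
      rw [e', Set.ncard_coe_finset, Finset.card_range] at this
      rw [← this, ← e']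
      rfl
    rw [this, if_pos h]
    lia
  · have : IsEmpty {c : ℕ // (c : ℤ) ≤ a ∧ (c : ℤ) ≤ b} := ⟨fun c => h (by have := c.2; lia)⟩
    rw [Nat.card_of_isEmpty, if_neg h]
    rfl

/-- The Weyl denominator is inverse to the partition function. -/
theorem kp_difference (a b : ℤ) :
    kp (a, b) - kp (a - 1, b) - kp (a, b - 1) + kp (a - 1, b - 2) + kp (a - 2, b - 1)
      - kp (a - 2, b - 2) = if a = 0 ∧ b = 0 then 1 else 0 := by
  -- dividing by `1 - e^(-α₁)` first leaves the partitions into `α₂` and `α₁ + α₂`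
  have h1 : ∀ a b, kp (a, b) - kp (a - 1, b) = if 0 ≤ a ∧ a ≤ b then 1 else 0 := by
    intro a b
    simp only [kp]
    split_ifs <;> lia
  have e1 := h1 a b
  have e2 := h1 a (b - 1)
  have e3 := h1 (a - 1) (b - 1)
  have e4 := h1 (a - 1) (b - 2)
  rw [sub_sub] at e3 e4
  norm_num at e3 e4
  split_ifs at * <;> lia

/-- With `m = ⟨λ, α₁⟩` and `λ - μ = a α₁ + b α₂`, this is the invariance of
`K_(λ - μ) - K_(s₁·λ - μ)` under the reflection `μ ↦ s₁ μ`. -/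
theorem kp_swap₁ (a b m : ℤ) :
    kp (a, b) - kp (a - m - 1, b) = kp (m + b - a, b) - kp (b - a - 1, b) := by
  simp only [kp]
  split_ifs <;> lia

theorem kp_symm (a b : ℤ) : kp (b, a) = kp (a, b) := by
  simp only [kp, and_comm, min_comm]

/-! ### Irreducible characters of `sl(3)` as Laurent polynomials -/

/-- The group ring of the root lattice, written in the basis of the simple roots. -/
abbrev Laurent : Type := AddMonoidAlgebra ℤ (ℤ × ℤ)

/-- The multiplicity `m̄^λ_μ` in coordinates; here `(1, 1)` is `ρ`. -/
def mult (lam mu : ℤ × ℤ) : ℤ :=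
  ∑ w : Weyl 3, det w * kp (coordAct w (lam + (1, 1)) - (1, 1) - mu)

/-- The weight multiplicities are invariant under the Weyl group. -/
theorem mult_coordAct (w : Weyl 3) (lam mu : ℤ × ℤ) : mult lam (coordAct w mu) = mult lam mu := by
  induction w using weyl_induction generalizing mu with
  | one => rw [coordAct_one]
  | mul u w hu hw => rw [coordAct_mul, hu, hw]
  | s₁ =>
    -- the terms of `w` and `s₁ w` are combined
    have key (p q c d : ℤ) : kp (p - 1 - c, q - 1 - d) - kp (q - p - 1 - c, q - 1 - d)
        = kp (p - 1 - (d - c), q - 1 - d) - kp (q - p - 1 - (d - c), q - 1 - d) := by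
      convert kp_swap₁ (p - 1 - c) (q - 1 - d) (2 * p - q - 1) using 4 <;> ring
    obtain ⟨c, d⟩ := mu
    obtain ⟨a, b⟩ := lam
    simp only [mult, coordAct_swap₁]
    rw [Prod.mk_add_mk, sum_det_mul_coordAct (fun v => kp (v - (1, 1) - (d - c, d))),
      sum_det_mul_coordAct (fun v => kp (v - (1, 1) - (c, d)))]
    simp only [Prod.mk_sub_mk]
    have e1 := key (a + 1) (b + 1) c d
    have e2 := key (b + 1 - (a + 1)) (-(a + 1)) c d
    have e3 := key (-(b + 1)) (a + 1 - (b + 1)) c d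
    ring_nf at *
    linarith
  | s₂ =>
    have key (p q c d : ℤ) : kp (p - 1 - c, q - 1 - d) - kp (p - 1 - c, p - q - 1 - d)
        = kp (p - 1 - c, q - 1 - (c - d)) - kp (p - 1 - c, p - q - 1 - (c - d)) := by
      simp only [← kp_symm (p - 1 - c)]
      convert kp_swap₁ (q - 1 - d) (p - 1 - c) (2 * q - p - 1) using 4 <;> ring
    obtain ⟨c, d⟩ := mu
    obtain ⟨a, b⟩ := lam
    simp only [mult, coordAct_swap₂]
    rw [Prod.mk_add_mk, sum_det_mul_coordAct (fun v => kp (v - (1, 1) - (c, c - d))),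
      sum_det_mul_coordAct (fun v => kp (v - (1, 1) - (c, d)))]
    simp only [Prod.mk_sub_mk]
    have e1 := key (a + 1) (b + 1) c d
    have e2 := key (b + 1 - (a + 1)) (-(a + 1)) c d
    have e3 := key (-(b + 1)) (a + 1 - (b + 1)) c d
    ring_nf at *
    linarith

theorem kp_eq_zero {v : ℤ × ℤ} (h : ¬(0 ≤ v.1 ∧ 0 ≤ v.2)) : kp v = 0 := if_neg h

/-- The multiplicities of a weight vanish above a bound, hence, by symmetry, below one too. -/
theorem mult_support_finite (lam : ℤ × ℤ) : {mu | mult lam mu ≠ 0}.Finite := by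
  obtain ⟨C, hC⟩ : ∃ C : ℤ, ∀ w : Weyl 3,
      (coordAct w (lam + (1, 1))).1 ≤ C ∧ (coordAct w (lam + (1, 1))).2 ≤ C := by
    refine ⟨∑ w : Weyl 3, (|(coordAct w (lam + (1, 1))).1| + |(coordAct w (lam + (1, 1))).2|),
      fun w => ?_⟩
    have := Finset.single_le_sum (f := fun w : Weyl 3 =>
      |(coordAct w (lam + (1, 1))).1| + |(coordAct w (lam + (1, 1))).2|)
      (fun _ _ => by positivity) (Finset.mem_univ w)
    constructor
    · linarith [le_abs_self (coordAct w (lam + (1, 1))).1,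
        abs_nonneg (coordAct w (lam + (1, 1))).2]
    · linarith [le_abs_self (coordAct w (lam + (1, 1))).2,
        abs_nonneg (coordAct w (lam + (1, 1))).1]
  have bound : ∀ mu, mult lam mu ≠ 0 → mu.1 ≤ C ∧ mu.2 ≤ C := by
    intro mu h
    obtain ⟨w, -, hw⟩ := Finset.exists_ne_zero_of_sum_ne_zero h
    have := not_imp_comm.1 kp_eq_zero (right_ne_zero_of_mul hw)
    simp only [Prod.fst_sub, Prod.snd_sub] at this
    have := hC w
    constructor <;> linarith
  refine (Set.finite_Icc ((-C, -C) : ℤ × ℤ) (C, C)).subset fun mu h => ?_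
  have h1 := bound mu h
  have h2 := bound (coordAct (Equiv.swap 0 1 * Equiv.swap 1 2 * Equiv.swap 0 1) mu)
    (by rw [mult_coordAct]; exact h)
  obtain ⟨c, d⟩ := mu
  rw [coordAct_mul, coordAct_mul, coordAct_swap₁, coordAct_swap₂, coordAct_swap₁] at h2
  simp only [Set.mem_Icc, Prod.mk_le_mk] at *
  lia

/-- The character `∑_μ m̄^λ_μ e^μ` with highest weight `λ`, for any `λ` in the root lattice. -/
def irrChar (lam : ℤ × ℤ) : Laurent :=
  .ofCoeff (Finsupp.ofSupportFinite (mult lam) (mult_support_finite lam))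

theorem coeff_irrChar (lam mu : ℤ × ℤ) : (irrChar lam).coeff mu = mult lam mu := rfl

/-- The alternating sum `∑_w det(w) e^(w v)`. -/
def alt (v : ℤ × ℤ) : Laurent := ∑ w : Weyl 3, AddMonoidAlgebra.single (coordAct w v) (det w)

/-- The Weyl character formula. -/
theorem alt_rho_mul_irrChar (lam : ℤ × ℤ) : alt (1, 1) * irrChar lam = alt (lam + (1, 1)) := by
  ext nu
  have key (x : ℤ × ℤ) : ∑ w : Weyl 3, det w * kp (x - (1, 1) - (-coordAct w (1, 1) + nu))
      = if x = nu then 1 else 0 := by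
    obtain ⟨a, b⟩ := x
    obtain ⟨c, d⟩ := nu
    rw [sum_det_mul_coordAct (fun v => kp ((a, b) - (1, 1) - (-v + (c, d))))]
    have h := kp_difference (a - c) (b - d)
    have hi : (a, b) = (c, d) ↔ a - c = 0 ∧ b - d = 0 := by
      rw [Prod.mk.injEq, sub_eq_zero, sub_eq_zero]
    simp only [hi, ← h, Prod.neg_mk, Prod.mk_add_mk, Prod.mk_sub_mk]
    ring_nf
  simp only [alt, Finset.sum_mul, AddMonoidAlgebra.coeff_sum, Finsupp.finsetSum_apply,
    AddMonoidAlgebra.coeff_single_mul_apply, coeff_irrChar, mult, Finset.mul_sum]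
  rw [Finset.sum_comm]
  refine Finset.sum_congr rfl fun u _ => ?_
  rw [AddMonoidAlgebra.coeff_single, Finsupp.single_apply,
    ← mul_one (det u), ← mul_ite_zero, ← key, Finset.mul_sum]
  exact Finset.sum_congr rfl fun w _ => by ring

/-- The Weyl group acting on Laurent polynomials. -/
def actRing (w : Weyl 3) : Laurent →+* Laurent :=
  AddMonoidAlgebra.mapDomainRingHom ℤ (coordAct w)

theorem actRing_single (w : Weyl 3) (v : ℤ × ℤ) (r : ℤ) :
    actRing w (AddMonoidAlgebra.single v r) = AddMonoidAlgebra.single (coordAct w v) r :=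
  AddMonoidAlgebra.mapDomain_single

theorem coeff_actRing (w : Weyl 3) (p : Laurent) (v : ℤ × ℤ) :
    (actRing w p).coeff v = p.coeff (coordAct w⁻¹ v) := by
  induction p using AddMonoidAlgebra.induction_linear with
  | zero => simp
  | add p q hp hq => simp [hp, hq]
  | single u r =>
    rw [actRing_single, AddMonoidAlgebra.coeff_single, AddMonoidAlgebra.coeff_single,
      Finsupp.single_apply, Finsupp.single_apply]
    refine if_congr ⟨?_, ?_⟩ rfl rfl
    · rintro rfl
      rw [coordAct_inv_self]
    · rintro rfl
      rw [coordAct_self_inv]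

theorem actRing_irrChar (w : Weyl 3) (lam : ℤ × ℤ) : actRing w (irrChar lam) = irrChar lam := by
  ext mu
  rw [coeff_actRing, coeff_irrChar, coeff_irrChar, mult_coordAct]

/-! ### The grading by `Q / 3 P` -/

/-- The component of class `k` of a Laurent polynomial. -/
def comp (k : ZMod 3) : Laurent →+ Laurent where
  toFun p := .ofCoeff (p.coeff.filter fun v => cls v = k)
  map_zero' := by simp [Finsupp.filter_zero]
  map_add' p q := by simp [Finsupp.filter_add]

theorem coeff_comp (k : ZMod 3) (p : Laurent) (v : ℤ × ℤ) :
    (comp k p).coeff v = if cls v = k then p.coeff v else 0 :=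
  Finsupp.filter_apply _ _ _

theorem comp_single (k : ZMod 3) (v : ℤ × ℤ) (r : ℤ) :
    comp k (AddMonoidAlgebra.single v r)
      = if cls v = k then AddMonoidAlgebra.single v r else 0 := by
  ext u
  rw [coeff_comp]
  by_cases h : v = u
  · subst h
    split_ifs <;> simp
  · split_ifs <;> simp [h]

theorem comp_comp (j k : ZMod 3) (p : Laurent) :
    comp j (comp k p) = if j = k then comp k p else 0 := by
  ext v
  rw [coeff_comp, coeff_comp]
  split_ifs <;> simp_all [coeff_comp]

theorem sum_comp (p : Laurent) : comp 0 p + comp 1 p + comp 2 p = p := by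
  ext v
  have : ∀ k : ZMod 3, k = 0 ∨ k = 1 ∨ k = 2 := by decide
  have h01 : (0 : ZMod 3) ≠ 1 := by decide
  have h02 : (0 : ZMod 3) ≠ 2 := by decide
  have h12 : (1 : ZMod 3) ≠ 2 := by decide
  rcases this (cls v) with h | h | h <;> simp [coeff_comp, h, h01, h02, h12, h01.symm, h02.symm,
    h12.symm]

theorem comp_mul (k : ZMod 3) (p q : Laurent) :
    comp k (p * q)
      = comp 0 p * comp k q + comp 1 p * comp (k - 1) q + comp 2 p * comp (k - 2) q := by
  have hom : ∀ (j : ZMod 3) (v : ℤ × ℤ) (r : ℤ) (q : Laurent), cls v = j →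
      comp k (AddMonoidAlgebra.single v r * q) = AddMonoidAlgebra.single v r * comp (k - j) q := by
    intro j v r q hv
    ext u
    rw [coeff_comp, AddMonoidAlgebra.coeff_single_mul_apply,
      AddMonoidAlgebra.coeff_single_mul_apply, coeff_comp, map_add cls, map_neg cls, hv, mul_ite,
      mul_zero]
    refine if_congr ?_ rfl rfl
    rw [neg_add_eq_sub, sub_left_inj]
  induction p using AddMonoidAlgebra.induction_linear with
  | zero => simp
  | add p p' hp hp' => simp only [add_mul, map_add, hp, hp']; ring
  | single v r =>
    have : ∀ k : ZMod 3, k = 0 ∨ k = 1 ∨ k = 2 := by decide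
    have h01 : (0 : ZMod 3) ≠ 1 := by decide
    have h02 : (0 : ZMod 3) ≠ 2 := by decide
    have h12 : (1 : ZMod 3) ≠ 2 := by decide
    rcases this (cls v) with h | h | h <;> rw [hom _ v r q h] <;>
      simp [comp_single, h, h01, h02, h12, h01.symm, h02.symm, h12.symm]

theorem comp_actRing (w : Weyl 3) (k : ZMod 3) (p : Laurent) :
    actRing w (comp k p) = comp ((det w : ZMod 3) * k) (actRing w p) := by
  ext v
  have h : (det w : ZMod 3) * det w = 1 := by
    exact_mod_cast congrArg (Int.cast (R := ZMod 3)) (det_mul_self w)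
  rw [coeff_actRing, coeff_comp, coeff_comp, coeff_actRing, cls_coordAct, det_inv]
  refine if_congr ⟨?_, ?_⟩ rfl rfl <;> intro e
  · rw [← e, ← mul_assoc, h, one_mul]
  · rw [e, ← mul_assoc, h, one_mul]

theorem coeff_alt (v u : ℤ × ℤ) :
    (alt v).coeff u = ∑ w : Weyl 3, det w * if coordAct w v = u then 1 else 0 := by
  simp [alt, Finsupp.single_apply]

theorem comp_zero_alt {v : ℤ × ℤ} (h : cls v ≠ 0) : comp 0 (alt v) = 0 := by
  rw [alt, map_sum]
  refine Finset.sum_eq_zero fun w _ => ?_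
  rw [comp_single, if_neg]
  rw [cls_coordAct]
  rcases det_eq w with e | e <;> simpa [e] using h

theorem comp_one_alt_rho_ne_zero : comp 1 (alt (1, 1)) ≠ 0 := by
  intro h
  have e : (comp 1 (alt (1, 1))).coeff (1, 1) = 0 := by rw [h]; rfl
  rw [coeff_comp, if_pos (by decide), coeff_alt,
    sum_det_mul_coordAct (fun v => if v = (1, 1) then 1 else 0)] at e
  norm_num at e

theorem alt_rho_ne_zero : alt (1, 1) ≠ 0 := fun h =>
  comp_one_alt_rho_ne_zero (by rw [h, map_zero])

theorem irrChar_zero : irrChar 0 = 1 :=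
  mul_left_cancel₀ alt_rho_ne_zero (by rw [alt_rho_mul_irrChar, zero_add, mul_one])

theorem cls_rho : cls (1, 1) = 1 := by decide

/-- The components of the Weyl character formula. As `λ + ρ` does not lie in `3 P`, the numerator
has no component of class `0`. -/
theorem comp_alt_rho_mul {lam : ℤ × ℤ} (h : cls lam ≠ 2) :
    comp 1 (alt (1, 1)) * comp 2 (irrChar lam) + comp 2 (alt (1, 1)) * comp 1 (irrChar lam) = 0 ∧
    comp 1 (alt (1, 1)) * comp 0 (irrChar lam) + comp 2 (alt (1, 1)) * comp 2 (irrChar lam)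
      = comp 1 (alt (lam + (1, 1))) ∧
    comp 1 (alt (1, 1)) * comp 1 (irrChar lam) + comp 2 (alt (1, 1)) * comp 0 (irrChar lam)
      = comp 2 (alt (lam + (1, 1))) := by
  have h0 : comp 0 (alt (1, 1)) = 0 := comp_zero_alt (by rw [cls_rho]; decide)
  have h' : cls (lam + (1, 1)) ≠ 0 := by
    rw [map_add, cls_rho]
    revert h
    generalize cls lam = k
    revert k
    decide
  refine ⟨?_, ?_, ?_⟩
  · rw [← comp_zero_alt h', ← alt_rho_mul_irrChar, comp_mul, h0]
    simp [show (-1 : ZMod 3) = 2 by decide, show (-2 : ZMod 3) = 1 by decide]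
  · rw [← alt_rho_mul_irrChar, comp_mul, h0]
    simp [show (1 - 2 : ZMod 3) = 2 by decide]
  · rw [← alt_rho_mul_irrChar, comp_mul, h0]
    simp [show (2 - 1 : ZMod 3) = 1 by decide]

/-- The components of classes `1` and `2` of the irreducible characters are in the same ratio for
all the highest weights of classes `0` and `1`. -/
theorem comp_irrChar_comm {lam mu : ℤ × ℤ} (hl : cls lam ≠ 2) (hm : cls mu ≠ 2) :
    comp 2 (irrChar lam) * comp 1 (irrChar mu) = comp 2 (irrChar mu) * comp 1 (irrChar lam) := by
  refine mul_left_cancel₀ comp_one_alt_rho_ne_zero ?_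
  linear_combination comp 1 (irrChar mu) * (comp_alt_rho_mul hl).1
    - comp 1 (irrChar lam) * (comp_alt_rho_mul hm).1

/-- The part of an irreducible character on the image of the affine Weyl group, which consists of
the classes `0` and `1`. -/
def evenPart (lam : ℤ × ℤ) : Laurent := comp 0 (irrChar lam) + comp 1 (irrChar lam)

/-- The image of `evenPart` under a reflection. -/
def oddPart (lam : ℤ × ℤ) : Laurent := comp 0 (irrChar lam) + comp 2 (irrChar lam)

theorem actRing_evenPart {w : Weyl 3} (h : det w = 1) (lam : ℤ × ℤ) :
    actRing w (evenPart lam) = evenPart lam := by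
  simp [evenPart, comp_actRing, actRing_irrChar, h]

theorem actRing_evenPart' {w : Weyl 3} (h : det w = -1) (lam : ℤ × ℤ) :
    actRing w (evenPart lam) = oddPart lam := by
  simp [evenPart, oddPart, comp_actRing, actRing_irrChar, h, show (-1 : ZMod 3) = 2 by decide]

theorem comp_evenPart (lam : ℤ × ℤ) : comp 0 (evenPart lam) = comp 0 (irrChar lam) ∧
    comp 1 (evenPart lam) = comp 1 (irrChar lam) := by
  have h01 : (0 : ZMod 3) ≠ 1 := by decide
  simp [evenPart, comp_comp, h01, h01.symm]

theorem evenPart_mul_comm {lam mu : ℤ × ℤ} (hl : cls lam ≠ 2) (hm : cls mu ≠ 2) :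
    evenPart lam * comp 0 (irrChar mu) + oddPart lam * comp 1 (irrChar mu)
      = evenPart mu * comp 0 (irrChar lam) + oddPart mu * comp 1 (irrChar lam) := by
  unfold evenPart oddPart
  linear_combination comp_irrChar_comm hl hm

/-- If a Laurent polynomial has numerator `evenPart λ` times the class `1` part plus `oddPart λ`
times the class `2` part of the numerator of the character of `μ`, then its components of classes
`0` and `1` are those of the product of the characters. -/
theorem comp_add_comp_of_numerator {lam mu : ℤ × ℤ} (hl : cls lam ≠ 2) (hm : cls mu ≠ 2)
    {S : Laurent} (h : alt (1, 1) * S = evenPart lam * comp 1 (alt (mu + (1, 1)))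
      + oddPart lam * comp 2 (alt (mu + (1, 1)))) :
    comp 0 S + comp 1 S
      = evenPart lam * comp 0 (irrChar mu) + oddPart lam * comp 1 (irrChar mu) := by
  obtain ⟨l0, -, -⟩ := comp_alt_rho_mul hl
  obtain ⟨m0, m1, m2⟩ := comp_alt_rho_mul hm
  have hD := sum_comp (alt (1, 1))
  rw [comp_zero_alt (by rw [cls_rho]; decide), zero_add] at hD
  have c := comp_irrChar_comm hl hm
  -- the component of class `2` of `S` is determined along with the others, by the numerator
  have hS : S = comp 0 (irrChar lam) * irrChar mu + comp 2 (irrChar lam) * comp 1 (irrChar mu)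
      + comp 1 (irrChar lam) * comp 0 (irrChar mu)
      + comp 2 (irrChar lam) * comp 0 (irrChar mu) := by
    refine mul_left_cancel₀ alt_rho_ne_zero ?_
    have hP := sum_comp (irrChar mu)
    rw [h, ← m1, ← m2]
    unfold evenPart oddPart
    linear_combination -comp 0 (irrChar lam) * m0 - comp 0 (irrChar mu) * l0
      - comp 2 (alt (1, 1)) * c + alt (1, 1) * comp 0 (irrChar lam) * hP
      + (comp 0 (irrChar lam) * (comp 0 (irrChar mu) + comp 1 (irrChar mu) + comp 2 (irrChar mu))
        + comp 2 (irrChar lam) * comp 1 (irrChar mu) + comp 1 (irrChar lam) * comp 0 (irrChar mu)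
        + comp 2 (irrChar lam) * comp 0 (irrChar mu)) * hD
  have h01 : (0 : ZMod 3) ≠ 1 := by decide
  have h02 : (0 : ZMod 3) ≠ 2 := by decide
  have h12 : (1 : ZMod 3) ≠ 2 := by decide
  rw [hS]
  simp only [map_add, comp_mul, comp_comp, h01, h02, h12, h01.symm, h02.symm, h12.symm, if_true,
    if_false, evenPart, oddPart, sub_self, show (1 : ZMod 3) - 2 = 2 by decide,
    show (0 : ZMod 3) - 1 = 2 by decide, show (0 : ZMod 3) - 2 = 1 by decide]
  ring

/-! ### Cosets of the affine Weyl group -/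

theorem shift_mul (x y : ExtAffWeyl 3) : shift (x * y) = shift x + act x.right (shift y) := rfl

theorem right_mul (x y : ExtAffWeyl 3) : (x * y).right = x.right * y.right := rfl

theorem shift_mem (y : ExtAffWeyl 3) : shift y ∈ weightLattice 3 :=
  (y.left.toAdd : weightLattice 3).2

theorem ext_of_shift {x y : ExtAffWeyl 3} (h : shift x = shift y) (h' : x.right = y.right) :
    x = y :=
  SemidirectProduct.ext (Multiplicative.toAdd.injective (Subtype.ext h)) h'

/-- The coset of the affine Weyl group which contains `y`: the class of the coordinates of the
shift modulo `1`, all of which are congruent. -/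
def coset : ExtAffWeyl 3 →* Multiplicative (AddCircle (1 : ℚ)) where
  toFun y := Multiplicative.ofAdd ((shift y 0 : ℚ) : AddCircle (1 : ℚ))
  map_one' := rfl
  map_mul' x y := by
    rw [← ofAdd_add, ← AddCircle.coe_add]
    congr 1
    rw [← sub_eq_zero, ← AddCircle.coe_sub, AddCircle.coe_eq_zero_iff]
    obtain ⟨k, hk⟩ := (shift_mem y).2 (x.right⁻¹ 0) 0
    refine ⟨k, ?_⟩
    rw [shift_mul, Pi.add_apply, add_sub_add_left_eq_sub, zsmul_one, ← hk]
    rfl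

theorem coset_eq_one_iff (y : ExtAffWeyl 3) : coset y = 1 ↔ ∃ k : ℤ, shift y 0 = k := by
  change ((shift y 0 : ℚ) : AddCircle (1 : ℚ)) = 0 ↔ _
  rw [AddCircle.coe_eq_zero_iff]
  simp [eq_comm]

theorem root_mem_rootLattice (i j : Fin 3) : root i j ∈ rootLattice 3 :=
  AddSubgroup.subset_closure ⟨i, j, rfl⟩

theorem exists_int_of_mem_rootLattice {v : Fin 3 → ℚ} (hv : v ∈ rootLattice 3) (i : Fin 3) :
    ∃ k : ℤ, v i = k := by
  induction hv using AddSubgroup.closure_induction with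
  | mem v h =>
    obtain ⟨j, k, rfl⟩ := h
    exact ⟨(Pi.single j 1 - Pi.single k 1 : Fin 3 → ℤ) i, by simp [root, Pi.single_apply]⟩
  | zero => exact ⟨0, by simp⟩
  | add v v' _ _ h h' =>
    obtain ⟨k, e⟩ := h
    obtain ⟨k', e'⟩ := h'
    exact ⟨k + k', by simp [e, e']⟩
  | neg v _ h =>
    obtain ⟨k, e⟩ := h
    exact ⟨-k, by simp [e]⟩

theorem mem_affWeyl_iff (y : ExtAffWeyl 3) : y ∈ affWeyl 3 ↔ coset y = 1 := by
  rw [coset_eq_one_iff]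
  refine ⟨fun h => exists_int_of_mem_rootLattice h 0, ?_⟩
  rintro ⟨k, hk⟩
  obtain ⟨hs, hd⟩ := shift_mem y
  obtain ⟨l, hl⟩ := hd 0 2
  rw [Fin.sum_univ_three] at hs
  have h : shift y = k • root 0 1 + (l - k) • root 1 2 := by
    rw [root_zero_one, root_one_two]
    ext i
    fin_cases i <;> simp <;> linarith
  change shift y ∈ rootLattice 3
  rw [h]
  exact add_mem (zsmul_mem (root_mem_rootLattice 0 1) _) (zsmul_mem (root_mem_rootLattice 1 2) _)

theorem mul_inv_mem_affWeyl_iff (y z : ExtAffWeyl 3) :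
    z * y⁻¹ ∈ affWeyl 3 ↔ coset z = coset y := by
  rw [mem_affWeyl_iff, map_mul, map_inv, mul_inv_eq_one]

theorem coset_ofWeyl (w : Weyl 3) : coset (ofWeyl w) = 1 := rfl

/-! ### The map `ι` in coordinates -/

theorem rho_three : rho 3 = fun i => ((rootVec (1, 1) i : ℤ) : ℚ) := by
  have hu : (Finset.univ : Finset {p : Fin 3 × Fin 3 // p.1 < p.2}) =
    {⟨(0, 1), by decide⟩, ⟨(0, 2), by decide⟩, ⟨(1, 2), by decide⟩} := by decide
  rw [rho, hu, Finset.sum_insert (by decide), Finset.sum_insert (by decide), Finset.sum_singleton,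
    root_zero_one, root_zero_two, root_one_two]
  ext i
  fin_cases i <;> simp [rootVec] <;> norm_num

theorem rootVec_one_one (i : Fin 3) : rootVec (1, 1) i = 1 - (i : ℤ) := by
  fin_cases i <;> simp [rootVec]

theorem act_rootVec (w : Weyl 3) (v : ℤ × ℤ) :
    act w (fun i => ((rootVec v i : ℤ) : ℚ)) = fun i => ((rootVec (coordAct w v) i : ℤ) : ℚ) := by
  funext i
  rw [rootVec_coordAct]
  rfl

theorem iota_apply (y : ExtAffWeyl 3) (i : Fin 3) :
    iota y i = -3 * shift y (y.right i) + rho 3 (y.right i) - rho 3 i := by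
  simp only [iota, dotAct, act, Pi.add_apply, Pi.smul_apply, Pi.neg_apply, Pi.sub_apply, inv_inv,
    smul_eq_mul, zero_add]
  push_cast
  ring

theorem iota_mul (x y : ExtAffWeyl 3) : iota (x * y) = act y.right⁻¹ (iota x) + iota y := by
  funext i
  have h : shift (x * y) ((x * y).right i)
      = shift x (x.right (y.right i)) + shift y (y.right i) := by
    rw [shift_mul, right_mul]
    simp [act]
  have h' : act y.right⁻¹ (iota x) i = iota x (y.right i) := by simp [act]
  rw [Pi.add_apply, h', iota_apply, iota_apply, iota_apply, h, right_mul, Equiv.Perm.mul_apply]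
  ring

theorem exists_iota_eq (y : ExtAffWeyl 3) :
    ∃ v : ℤ × ℤ, iota y = fun i => ((rootVec v i : ℤ) : ℚ) := by
  obtain ⟨hs, hd⟩ := shift_mem y
  have h3 : ∀ i, ∃ k : ℤ, 3 * shift y i = k := by
    intro i
    obtain ⟨k, hk⟩ := hd i 0
    obtain ⟨l, hl⟩ := hd i 1
    obtain ⟨m, hm⟩ := hd i 2
    rw [Fin.sum_univ_three] at hs
    exact ⟨k + l + m, by push_cast; linarith⟩
  choose k hk using h3
  let n : Fin 3 → ℤ := fun i =>
    -k (y.right i) + rootVec (1, 1) (y.right i) - rootVec (1, 1) i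
  have hn : ∀ i, iota y i = n i := by
    intro i
    rw [iota_apply, rho_three]
    push_cast [n]
    rw [← hk]
    ring
  have hsum : ∑ i, n i = 0 := by
    have e : ∑ i, iota y i = 0 := by
      simp only [iota_apply, Finset.sum_sub_distrib, Finset.sum_add_distrib, ← Finset.mul_sum]
      rw [Equiv.sum_comp y.right (shift y), Equiv.sum_comp y.right (rho 3), hs]
      ring
    simp only [hn] at e
    exact_mod_cast e
  refine ⟨(n 0, -n 2), funext fun i => ?_⟩
  rw [Fin.sum_univ_three] at hsum
  rw [hn, Int.cast_inj]
  fin_cases i <;> simp [rootVec]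
  lia

/-- The coordinates of `ι y` with respect to the simple roots. -/
def iotaCoord (y : ExtAffWeyl 3) : ℤ × ℤ := (exists_iota_eq y).choose

theorem iota_eq (y : ExtAffWeyl 3) : iota y = fun i => ((rootVec (iotaCoord y) i : ℤ) : ℚ) :=
  (exists_iota_eq y).choose_spec

theorem rootVec_cast_injective {u v : ℤ × ℤ}
    (h : (fun i => ((rootVec u i : ℤ) : ℚ)) = fun i => ((rootVec v i : ℤ) : ℚ)) : u = v :=
  rootVec_injective <| funext fun i => Int.cast_injective (congrFun h i)

/-- The cocycle property of `ι`. -/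
theorem iotaCoord_mul (x y : ExtAffWeyl 3) :
    iotaCoord (x * y) = coordAct y.right⁻¹ (iotaCoord x) + iotaCoord y := by
  apply rootVec_cast_injective
  rw [← iota_eq, iota_mul, iota_eq x, iota_eq y, act_rootVec]
  funext i
  simp

theorem iotaCoord_ofWeyl (w : Weyl 3) : iotaCoord (ofWeyl w) = coordAct w⁻¹ (1, 1) - (1, 1) := by
  apply rootVec_cast_injective
  rw [← iota_eq, iota]
  funext i
  have hs : shift (ofWeyl w) = 0 := rfl
  have hr : (ofWeyl w).right = w := rfl
  rw [hs, hr, dotAct, zero_add, rho_three, act_rootVec]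
  simp [act]

theorem iotaCoord_one : iotaCoord 1 = 0 := by
  have := iotaCoord_mul 1 1
  rwa [mul_one, SemidirectProduct.one_right, inv_one, coordAct_one, left_eq_add] at this

/-- Multiplication by the Weyl group on the right corresponds to the shifted action. -/
theorem iotaCoord_mul_ofWeyl (y : ExtAffWeyl 3) (w : Weyl 3) :
    iotaCoord (y * ofWeyl w) + (1, 1) = coordAct w⁻¹ (iotaCoord y + (1, 1)) := by
  rw [iotaCoord_mul, iotaCoord_ofWeyl, map_add]
  change coordAct w⁻¹ _ + _ + _ = _
  abel

theorem cls_eq (v : ℤ × ℤ) : cls v = -((rootVec v 0 - rootVec v 2 : ℤ) : ZMod 3) := by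
  simp [cls, rootVec]

theorem cls_iotaCoord (y : ExtAffWeyl 3) : cls (iotaCoord y) = (det y.right : ZMod 3) - 1 := by
  have h : cls (iotaCoord y - (coordAct y.right⁻¹ (1, 1) - (1, 1))) = 0 := by
    obtain ⟨k, hk⟩ := (shift_mem y).2 (y.right 0) (y.right 2)
    have e (i : Fin 3) : ((rootVec (iotaCoord y - (coordAct y.right⁻¹ (1, 1) - (1, 1))) i : ℤ) : ℚ)
        = -3 * shift y (y.right i) := by
      have := congrFun (iota_eq y) i
      rw [iota_apply, rho_three] at this
      rw [map_sub, map_sub, Pi.sub_apply, Pi.sub_apply, rootVec_coordAct, inv_inv, Int.cast_sub,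
        Int.cast_sub, ← this]
      ring
    rw [cls_eq, neg_eq_zero, ZMod.intCast_zmod_eq_zero_iff_dvd]
    refine ⟨-k, ?_⟩
    have : (((rootVec (iotaCoord y - (coordAct y.right⁻¹ (1, 1) - (1, 1))) 0 : ℤ) -
      (rootVec (iotaCoord y - (coordAct y.right⁻¹ (1, 1) - (1, 1))) 2 : ℤ) : ℤ) : ℚ)
        = ((3 * -k : ℤ) : ℚ) := by
      rw [Int.cast_sub, e, e]
      push_cast
      rw [← hk]
      ring
    exact_mod_cast this
  rw [map_sub, sub_eq_zero] at h
  rw [h, map_sub, cls_coordAct, det_inv, cls_rho, mul_one]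

theorem cls_iotaCoord_ne_two (y : ExtAffWeyl 3) : cls (iotaCoord y) ≠ 2 := by
  rw [cls_iotaCoord]
  rcases det_eq y.right with h | h <;> rw [h] <;> decide

/-- On each coset of the affine Weyl group, `ι` is injective. -/
theorem eq_of_iotaCoord_eq {x y : ExtAffWeyl 3} (hc : coset x = coset y)
    (h : iotaCoord x = iotaCoord y) : x = y := by
  rw [← mul_inv_eq_one]
  set g := x * y⁻¹ with hg
  have hxg : x = g * y := by rw [hg, inv_mul_cancel_right]
  have hi : iotaCoord g = 0 := by
    rw [hxg, iotaCoord_mul, add_eq_right] at h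
    rw [← coordAct_self_inv y.right⁻¹⁻¹ (iotaCoord g), inv_inv, h, map_zero]
  have hw : g ∈ affWeyl 3 := (mul_inv_mem_affWeyl_iff y x).2 hc
  have hz : ∀ i, shift g (g.right i) = 0 ∧ g.right i = i := by
    intro i
    obtain ⟨k, hk⟩ := exists_int_of_mem_rootLattice hw (g.right i)
    have e := congrFun (iota_eq g) i
    rw [hi, iota_apply, rho_three, hk, map_zero, Pi.zero_apply] at e
    beta_reduce at e
    have e' : -3 * k + rootVec (1, 1) (g.right i) - rootVec (1, 1) i = 0 := by exact_mod_cast e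
    rw [rootVec_one_one, rootVec_one_one] at e'
    have h1 := (g.right i).isLt
    have h2 := i.isLt
    have hk0 : k = 0 := by omega
    refine ⟨by rw [hk, hk0, Int.cast_zero], Fin.ext ?_⟩
    omega
  have hr : g.right = 1 := Equiv.ext fun i => (hz i).2
  refine ext_of_shift (funext fun i => ?_) hr
  have := (hz i).1
  rwa [hr] at this

/-- On the affine Weyl group, `ι` takes every value of class `0` or `1`. -/
theorem exists_iotaCoord_eq_of_affWeyl {v : ℤ × ℤ} (h : cls v ≠ 2) :
    ∃ g : ExtAffWeyl 3, coset g = 1 ∧ iotaCoord g = v := by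
  set u := v + (1, 1) with hu
  have hcls : cls u ≠ 0 := by
    rw [hu, map_add, cls_rho]
    revert h
    generalize cls v = k
    revert k
    decide
  -- the coordinates of `v + ρ` represent all the classes modulo `3`, like those of `ρ`
  let σ : Fin 3 → Fin 3 := fun i => (1 - (rootVec u i : ZMod 3) : ZMod 3)
  have hσ : Function.Injective σ := by
    obtain ⟨a, b⟩ := u
    have hab : -((a : ZMod 3) + b) ≠ 0 := by simpa [cls] using hcls
    have e0 : σ 0 = (1 - (a : ZMod 3) : ZMod 3) := by simp [σ, rootVec]; rfl
    have e1 : σ 1 = (1 - ((b : ZMod 3) - a) : ZMod 3) := by simp [σ, rootVec]; rfl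
    have e2 : σ 2 = (1 - (-b : ZMod 3) : ZMod 3) := by simp [σ, rootVec]; rfl
    have key : ∀ a b : ZMod 3, -(a + b) ≠ 0 → 1 - a ≠ 1 - (b - a) ∧ 1 - a ≠ 1 - (-b) ∧
      1 - (b - a) ≠ 1 - (-b) := by decide
    obtain ⟨h1, h2, h3⟩ := key a b hab
    intro i j hij
    fin_cases i <;> fin_cases j <;> first | rfl | skip
    · exact absurd (e0.symm.trans (hij.trans e1)) h1
    · exact absurd (e0.symm.trans (hij.trans e2)) h2
    · exact absurd (e0.symm.trans (hij.symm.trans e1)) h1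
    · exact absurd (e1.symm.trans (hij.trans e2)) h3
    · exact absurd (e0.symm.trans (hij.symm.trans e2)) h2
    · exact absurd (e1.symm.trans (hij.symm.trans e2)) h3
  let w : Weyl 3 := Equiv.ofBijective σ (Finite.injective_iff_bijective.1 hσ)
  have hdvd : ∀ i, ∃ k : ℤ, rootVec (1, 1) (w i) - rootVec u i = 3 * k := by
    intro i
    rw [← dvd_def, ← Nat.cast_ofNat, ← ZMod.intCast_zmod_eq_zero_iff_dvd, rootVec_one_one]
    have : ((((w i : Fin 3) : ℕ) : ℤ) : ZMod 3) = 1 - (rootVec u i : ZMod 3) := by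
      rw [Int.cast_natCast]
      exact ZMod.natCast_zmod_val (1 - (rootVec u i : ZMod 3) : ZMod 3)
    push_cast at this ⊢
    rw [this]
    ring
  choose k hk using hdvd
  have hks : ∑ i, k i = 0 := by
    have : 3 * ∑ i, k i = 0 := by
      rw [Finset.mul_sum, ← Finset.sum_congr rfl fun i _ => hk i, Finset.sum_sub_distrib,
        Equiv.sum_comp w, sum_rootVec, sum_rootVec, sub_zero]
    lia
  let β : weightLattice 3 := ⟨fun i => (k (w⁻¹ i) : ℚ), by
    rw [← Int.cast_sum, Equiv.sum_comp (w⁻¹ : Weyl 3) k, hks, Int.cast_zero],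
    fun i j => ⟨k (w⁻¹ i) - k (w⁻¹ j), by push_cast; rfl⟩⟩
  refine ⟨⟨Multiplicative.ofAdd β, w⟩, (coset_eq_one_iff _).2 ⟨k (w⁻¹ 0), rfl⟩,
    rootVec_cast_injective ?_⟩
  rw [← iota_eq]
  funext i
  have hs : shift (⟨Multiplicative.ofAdd β, w⟩ : ExtAffWeyl 3) (w i) = k i := by
    change (k (w⁻¹ (w i)) : ℚ) = k i
    simp
  rw [iota_apply, hs, rho_three]
  have e := hk i
  rw [hu, map_add, Pi.add_apply] at e
  have e' : ((rootVec (1, 1) (w i) : ℤ) : ℚ) - (rootVec v i + rootVec (1, 1) i) = 3 * k i := by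
    exact_mod_cast e
  linarith

/-- On each coset of the affine Weyl group, `ι` takes every value of class `0` or `1`. -/
theorem exists_iotaCoord_eq (y : ExtAffWeyl 3) {v : ℤ × ℤ} (h : cls v ≠ 2) :
    ∃ z : ExtAffWeyl 3, coset z = coset y ∧ iotaCoord z = v := by
  obtain ⟨g, hg, hg'⟩ := exists_iotaCoord_eq_of_affWeyl
    (v := coordAct y.right (v - iotaCoord y)) (by
      rw [cls_coordAct, map_sub, cls_iotaCoord]
      revert h
      generalize cls v = k
      revert k
      rcases det_eq y.right with e | e <;> rw [e] <;> decide)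
  refine ⟨g * y, by rw [map_mul, hg, one_mul], ?_⟩
  rw [iotaCoord_mul, hg', coordAct_inv_self, sub_add_cancel]

/-! ### The generalised weight multiplicities -/

theorem weightMult_rootVec (lam mu : ℤ × ℤ) :
    weightMult (fun i => ((rootVec lam i : ℤ) : ℚ)) (fun i => ((rootVec mu i : ℤ) : ℚ))
      = mult lam mu := by
  refine Finset.sum_congr rfl fun w _ => ?_
  rw [← kostant_rootVec]
  congr 3
  rw [dotAct, rho_three]
  have : ((fun i => ((rootVec lam i : ℤ) : ℚ)) + fun i => ((rootVec (1, 1) i : ℤ) : ℚ))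
      = fun i => ((rootVec (lam + (1, 1)) i : ℤ) : ℚ) := by funext i; simp
  rw [this, act_rootVec]
  funext i
  simp

theorem weightMult_iota (y z : ExtAffWeyl 3) :
    weightMult (iota y) (iota z) = mult (iotaCoord y) (iotaCoord z) := by
  rw [iota_eq, iota_eq, weightMult_rootVec]

theorem charMult_eq_weightMult {y z : ExtAffWeyl 3} (h : coset z = coset y) :
    charMult y z = weightMult (iota y) (iota z) := by
  rw [weightMult_iota, charMult, mult, ← Equiv.sum_comp (Equiv.inv (Weyl 3))]
  refine Finset.sum_congr rfl fun w _ => ?_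
  rw [Equiv.inv_apply, det_inv, vermaMult, if_pos, ← kostant_rootVec]
  · congr 3
    rw [iota_eq, iota_eq]
    funext i
    have := iotaCoord_mul_ofWeyl y w⁻¹
    rw [inv_inv] at this
    rw [← this, add_sub_cancel_right]
    simp
  · rw [mul_inv_mem_affWeyl_iff, map_mul, coset_ofWeyl, mul_one, h]

theorem charMult_eq_mult {y z : ExtAffWeyl 3} (h : coset z = coset y) :
    charMult y z = mult (iotaCoord y) (iotaCoord z) := by
  rw [charMult_eq_weightMult h, weightMult_iota]

theorem charMult_eq_zero {y z : ExtAffWeyl 3} (h : coset z ≠ coset y) : charMult y z = 0 := by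
  refine Finset.sum_eq_zero fun w _ => ?_
  rw [vermaMult, if_neg, mul_zero]
  rwa [mul_inv_mem_affWeyl_iff, map_mul, coset_ofWeyl, mul_one]

theorem coset_eq_of_charMult_ne_zero {y z : ExtAffWeyl 3} (h : charMult y z ≠ 0) :
    coset z = coset y :=
  not_imp_comm.1 charMult_eq_zero h

theorem charMult_support_finite (y : ExtAffWeyl 3) : {z | charMult y z ≠ 0}.Finite := by
  refine Set.Finite.of_finite_image (f := iotaCoord)
    ((mult_support_finite (iotaCoord y)).subset ?_) ?_
  · rintro _ ⟨z, hz, rfl⟩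
    change mult _ _ ≠ 0
    rw [← charMult_eq_mult (coset_eq_of_charMult_ne_zero hz)]
    exact hz
  · intro z hz z' hz' h
    exact eq_of_iotaCoord_eq ((coset_eq_of_charMult_ne_zero hz).trans
      (coset_eq_of_charMult_ne_zero hz').symm) h

/-! ### The characters in the group ring and their images under `ι` -/

theorem chi_eq_sum (y : ExtAffWeyl 3) :
    chi y = ∑ z ∈ (charMult_support_finite y).toFinset,
      MonoidAlgebra.single z (charMult y z) := by
  refine finsum_eq_sum_of_support_subset _ fun z hz => ?_
  rw [Set.Finite.coe_toFinset]
  exact fun h => hz (by simp only [h, MonoidAlgebra.single_zero])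

theorem coeff_chi (y z : ExtAffWeyl 3) : (chi y).coeff z = charMult y z := by
  classical
  rw [chi_eq_sum, MonoidAlgebra.coeff_sum, Finsupp.finsetSum_apply]
  simp only [MonoidAlgebra.coeff_single, Finsupp.single_apply]
  rw [Finset.sum_ite_eq']
  simp [eq_comm]

theorem chi_mul_ofWeyl (y : ExtAffWeyl 3) (w : Weyl 3) :
    chi (y * ofWeyl w) = det w • chi y := by
  ext z
  rw [coeff_chi, charMult_mul_ofWeyl, MonoidAlgebra.coeff_smul_apply, coeff_chi, smul_eq_mul]

/-- The group ring elements which are supported on a given coset of the affine Weyl group. -/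
def cosetPart (k : Multiplicative (AddCircle (1 : ℚ))) :
    AddSubgroup (MonoidAlgebra ℤ (ExtAffWeyl 3)) where
  carrier := {p | ∀ z, p.coeff z ≠ 0 → coset z = k}
  zero_mem' := fun z h => absurd rfl h
  add_mem' := by
    intro p q hp hq z h
    by_cases h' : p.coeff z = 0
    · refine hq z fun h'' => h ?_
      rw [MonoidAlgebra.coeff_add, Finsupp.add_apply, h', h'', add_zero]
    · exact hp z h'
  neg_mem' := fun {p} hp z h => hp z fun h' => h (by
    rw [MonoidAlgebra.coeff_neg, Finsupp.neg_apply, h', neg_zero])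

theorem mul_mem_cosetPart {k l : Multiplicative (AddCircle (1 : ℚ))}
    {p q : MonoidAlgebra ℤ (ExtAffWeyl 3)} (hp : p ∈ cosetPart k) (hq : q ∈ cosetPart l) :
    p * q ∈ cosetPart (k * l) := by
  classical
  intro z hz
  rw [MonoidAlgebra.coeff_mul] at hz
  obtain ⟨x, hx, hx'⟩ := Finset.exists_ne_zero_of_sum_ne_zero hz
  obtain ⟨y, hy, hy'⟩ := Finset.exists_ne_zero_of_sum_ne_zero hx'
  have hxy : x * y = z := by
    by_contra h
    exact hy' (if_neg h)
  rw [← hxy, map_mul, hp x (Finsupp.mem_support_iff.1 hx), hq y (Finsupp.mem_support_iff.1 hy)]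

theorem chi_mem_cosetPart (y : ExtAffWeyl 3) : chi y ∈ cosetPart (coset y) := fun z hz =>
  coset_eq_of_charMult_ne_zero (by rwa [coeff_chi] at hz)

/-- The linear extension of `ι` to the group ring. -/
def iotaLin : MonoidAlgebra ℤ (ExtAffWeyl 3) →+ Laurent :=
  (Finsupp.liftAddHom fun z => AddMonoidAlgebra.singleAddHom (iotaCoord z)).comp
    (MonoidAlgebra.coeffAddEquiv : MonoidAlgebra ℤ (ExtAffWeyl 3) ≃+ _).toAddMonoidHom

theorem iotaLin_single (z : ExtAffWeyl 3) (r : ℤ) :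
    iotaLin (MonoidAlgebra.single z r) = AddMonoidAlgebra.single (iotaCoord z) r := by
  simp [iotaLin]

theorem iotaLin_eq_sum (p : MonoidAlgebra ℤ (ExtAffWeyl 3)) :
    iotaLin p = p.coeff.sum fun z r => AddMonoidAlgebra.single (iotaCoord z) r := rfl

theorem coeff_iotaLin {k : Multiplicative (AddCircle (1 : ℚ))}
    {p : MonoidAlgebra ℤ (ExtAffWeyl 3)} (hp : p ∈ cosetPart k) {z : ExtAffWeyl 3}
    (hz : coset z = k) : (iotaLin p).coeff (iotaCoord z) = p.coeff z := by
  classical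
  rw [iotaLin_eq_sum, Finsupp.sum, AddMonoidAlgebra.coeff_sum, Finsupp.finsetSum_apply]
  simp only [AddMonoidAlgebra.coeff_single, Finsupp.single_apply]
  rw [Finset.sum_eq_single z]
  · simp
  · intro z' hz' hne
    refine if_neg fun h => hne (eq_of_iotaCoord_eq ?_ h)
    rw [hz, hp z' (Finsupp.mem_support_iff.1 hz')]
  · intro h
    rw [if_pos rfl]
    exact Finsupp.notMem_support_iff.1 h

/-- On each coset, `iotaLin` is injective. -/
theorem eq_of_iotaLin_eq {k : Multiplicative (AddCircle (1 : ℚ))}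
    {p q : MonoidAlgebra ℤ (ExtAffWeyl 3)} (hp : p ∈ cosetPart k) (hq : q ∈ cosetPart k)
    (h : iotaLin p = iotaLin q) : p = q := by
  ext z
  by_cases hz : coset z = k
  · rw [← coeff_iotaLin hp hz, ← coeff_iotaLin hq hz, h]
  · rw [not_imp_comm.1 (hp z) hz, not_imp_comm.1 (hq z) hz]

theorem coeff_iotaLin_of_cls_eq_two (p : MonoidAlgebra ℤ (ExtAffWeyl 3)) {v : ℤ × ℤ}
    (h : cls v = 2) : (iotaLin p).coeff v = 0 := by
  rw [iotaLin_eq_sum, Finsupp.sum, AddMonoidAlgebra.coeff_sum, Finsupp.finsetSum_apply]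
  refine Finset.sum_eq_zero fun z _ => ?_
  rw [AddMonoidAlgebra.coeff_single, Finsupp.single_apply, if_neg]
  rintro rfl
  exact cls_iotaCoord_ne_two z h

theorem iotaLin_chi (y : ExtAffWeyl 3) : iotaLin (chi y) = evenPart (iotaCoord y) := by
  ext v
  have h3 : ∀ k : ZMod 3, k = 0 ∨ k = 1 ∨ k = 2 := by decide
  have h01 : (0 : ZMod 3) ≠ 1 := by decide
  have h02 : (0 : ZMod 3) ≠ 2 := by decide
  have h12 : (1 : ZMod 3) ≠ 2 := by decide
  have hne (h : cls v ≠ 2) : (iotaLin (chi y)).coeff v = (irrChar (iotaCoord y)).coeff v := by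
    obtain ⟨z, hz, rfl⟩ := exists_iotaCoord_eq y h
    rw [coeff_iotaLin (chi_mem_cosetPart y) hz, coeff_chi, charMult_eq_mult hz, coeff_irrChar]
  rw [evenPart, AddMonoidAlgebra.coeff_add, Finsupp.add_apply, coeff_comp, coeff_comp]
  rcases h3 (cls v) with h | h | h
  · rw [hne (by rw [h]; exact h02), h, if_pos rfl, if_neg h01, add_zero]
  · rw [hne (by rw [h]; exact h12), h, if_pos rfl, if_neg h01.symm, zero_add]
  · rw [coeff_iotaLin_of_cls_eq_two _ h, h, if_neg h02.symm, if_neg h12.symm, add_zero]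

theorem iotaLin_mul_single (p : MonoidAlgebra ℤ (ExtAffWeyl 3)) (y : ExtAffWeyl 3) (r : ℤ) :
    iotaLin (p * MonoidAlgebra.single y r)
      = AddMonoidAlgebra.single (iotaCoord y) r * actRing y.right⁻¹ (iotaLin p) := by
  induction p using MonoidAlgebra.induction_linear with
  | zero => simp
  | add p q hp hq => rw [add_mul, map_add, hp, hq, map_add, map_add, mul_add]
  | single z s =>
    rw [MonoidAlgebra.single_mul_single, iotaLin_single, iotaLin_single, actRing_single,
      AddMonoidAlgebra.single_mul_single, iotaCoord_mul, add_comm, mul_comm]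

/-- Left multiplication by a character corresponds to the multiplication by `evenPart` in class
`0` and by `oddPart` in class `1`. -/
theorem iotaLin_chi_mul (x : ExtAffWeyl 3) (q : MonoidAlgebra ℤ (ExtAffWeyl 3)) :
    iotaLin (chi x * q) = evenPart (iotaCoord x) * comp 0 (iotaLin q)
      + oddPart (iotaCoord x) * comp 1 (iotaLin q) := by
  have h01 : (0 : ZMod 3) ≠ 1 := by decide
  induction q using MonoidAlgebra.induction_linear with
  | zero => simp
  | add p q hp hq => simp only [mul_add, map_add, hp, hq]; ring
  | single y r =>
    rw [iotaLin_mul_single, iotaLin_chi, iotaLin_single, comp_single, comp_single, cls_iotaCoord]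
    rcases det_eq y.right with h | h
    · rw [actRing_evenPart (by rw [det_inv, h]), h]
      simp [mul_comm]
    · rw [actRing_evenPart' (by rw [det_inv, h]), h]
      simp [show (-1 - 1 : ZMod 3) = 1 by decide, h01.symm, mul_comm]

theorem iotaLin_chi_mul_chi (x y : ExtAffWeyl 3) :
    iotaLin (chi x * chi y) = evenPart (iotaCoord x) * comp 0 (irrChar (iotaCoord y))
      + oddPart (iotaCoord x) * comp 1 (irrChar (iotaCoord y)) := by
  rw [iotaLin_chi_mul, iotaLin_chi, (comp_evenPart _).1, (comp_evenPart _).2]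

theorem chi_mul_comm (x y : ExtAffWeyl 3) : chi x * chi y = chi y * chi x := by
  refine eq_of_iotaLin_eq (mul_mem_cosetPart (chi_mem_cosetPart x) (chi_mem_cosetPart y)) ?_ ?_
  · rw [mul_comm]
    exact mul_mem_cosetPart (chi_mem_cosetPart y) (chi_mem_cosetPart x)
  · rw [iotaLin_chi_mul_chi, iotaLin_chi_mul_chi,
      evenPart_mul_comm (cls_iotaCoord_ne_two x) (cls_iotaCoord_ne_two y)]

theorem chi_one : chi (1 : ExtAffWeyl 3) = 1 := by
  refine eq_of_iotaLin_eq (chi_mem_cosetPart 1) ?_ ?_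
  · intro z hz
    by_contra h
    refine hz ?_
    rw [MonoidAlgebra.one_def, MonoidAlgebra.coeff_single, Finsupp.single_apply, if_neg]
    rintro rfl
    exact h rfl
  · rw [iotaLin_chi, iotaCoord_one, evenPart, irrChar_zero, MonoidAlgebra.one_def, iotaLin_single,
      iotaCoord_one, AddMonoidAlgebra.one_def, comp_single, comp_single, map_zero, if_pos rfl,
      if_neg (by decide), add_zero]

/-- The numerator of `∑_z m^x_z F(ι(z y))`, where `F(λ)` is the character of highest weight `λ`. The
term of `w` in the numerator of `F(ι(z y))` is that of `F(ι(y))` times `e^(w ȳ⁻¹ ι(z))`, so the sum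
over `z` produces the image of `χ_x` under `w ȳ⁻¹`. -/
theorem alt_rho_mul_sum (x y : ExtAffWeyl 3) :
    alt (1, 1) * ∑ z ∈ (charMult_support_finite x).toFinset,
        charMult x z • irrChar (iotaCoord (z * y))
      = evenPart (iotaCoord x) * comp 1 (alt (iotaCoord y + (1, 1)))
        + oddPart (iotaCoord x) * comp 2 (alt (iotaCoord y + (1, 1))) := by
  have h12 : (1 : ZMod 3) ≠ 2 := by decide
  set u := iotaCoord y + (1, 1) with hu
  calc _ = ∑ w : Weyl 3, AddMonoidAlgebra.single (coordAct w u) (det w) *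
        actRing (w * y.right⁻¹) (iotaLin (chi x)) := by
        simp only [Finset.mul_sum, mul_smul_comm, alt_rho_mul_irrChar, chi_eq_sum x, map_sum,
          iotaLin_single, actRing_single, AddMonoidAlgebra.single_mul_single]
        simp only [alt, Finset.smul_sum]
        rw [Finset.sum_comm]
        refine Finset.sum_congr rfl fun w _ => Finset.sum_congr rfl fun z _ => ?_
        rw [AddMonoidAlgebra.smul_single, smul_eq_mul, mul_comm, iotaCoord_mul, add_assoc, ← hu,
          map_add, coordAct_mul, add_comm]
    _ = _ := by
        simp only [alt, map_sum, Finset.mul_sum]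
        rw [← Finset.sum_add_distrib]
        refine Finset.sum_congr rfl fun w _ => ?_
        have hc : cls (coordAct w u) = (det (w * y.right⁻¹) : ZMod 3) := by
          rw [cls_coordAct, hu, map_add, cls_iotaCoord, cls_rho, sub_add_cancel, det_mul, det_inv,
            Int.cast_mul]
        rw [comp_single, comp_single, hc, iotaLin_chi]
        rcases det_eq (w * y.right⁻¹) with h | h
        · rw [actRing_evenPart h, h]
          simp [h12, mul_comm]
        · rw [actRing_evenPart' h, h]
          simp [show (-1 : ZMod 3) = 2 by decide, h12.symm, mul_comm]

/-- The product of two characters through the weight diagram of the first. -/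
theorem chi_mul_chi (x y : ExtAffWeyl 3) :
    chi x * chi y = ∑ z ∈ (charMult_support_finite x).toFinset,
      charMult x z • chi (z * y) := by
  refine eq_of_iotaLin_eq (mul_mem_cosetPart (chi_mem_cosetPart x) (chi_mem_cosetPart y)) ?_ ?_
  · refine sum_mem fun z hz => zsmul_mem ?_ _
    rw [Set.Finite.mem_toFinset] at hz
    rw [← coset_eq_of_charMult_ne_zero hz, ← map_mul]
    exact chi_mem_cosetPart _
  · rw [iotaLin_chi_mul_chi, ← comp_add_comp_of_numerator (cls_iotaCoord_ne_two x)
      (cls_iotaCoord_ne_two y) (alt_rho_mul_sum x y)]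
    simp only [map_sum, map_zsmul, iotaLin_chi, evenPart, smul_add, Finset.sum_add_distrib]

/-! ### The dominant chamber -/

theorem affAct_root (y : ExtAffWeyl 3) (i j : Fin 3) :
    affAct y (root i j, 0) = (root (y.right i) (y.right j),
      shift y (y.right j) - shift y (y.right i)) := by
  rw [affAct, act_root]
  congr 1
  simp [root, sub_dotProduct]

theorem root_inj {i j k l : Fin 3} (hij : i ≠ j) (h : (root i j : Fin 3 → ℚ) = root k l) :
    i = k ∧ j = l := by
  have hi := congrFun h i
  have hj := congrFun h j
  simp only [root, Pi.sub_apply, Pi.single_apply, if_true, if_neg hij, if_neg hij.symm] at hi hj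
  constructor
  · by_contra hne
    rw [if_neg hne] at hi
    split_ifs at hi <;> norm_num at hi
  · by_contra hne
    rw [if_neg hne] at hj
    split_ifs at hj <;> norm_num at hj

/-- The pairing of `ι y + ρ` with a root `α` is the height of the affine root `y α`. -/
theorem height_affAct {y : ExtAffWeyl 3} {i j k l : Fin 3} {m : ℤ} (hij : i ≠ j)
    (h : affAct y (root i j, 0) = (root k l, (m : ℚ))) :
    rootVec (iotaCoord y + (1, 1)) i - rootVec (iotaCoord y + (1, 1)) j = 3 * m + l - k := by
  rw [affAct_root, Prod.mk.injEq] at h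
  obtain ⟨rfl, rfl⟩ := root_inj (y.right.injective.ne hij) h.1
  have e (i : Fin 3) : ((rootVec (iotaCoord y + (1, 1)) i : ℤ) : ℚ)
      = -3 * shift y (y.right i) + (1 - (y.right i : ℤ) : ℤ) := by
    have := congrFun (iota_eq y) i
    rw [iota_apply, rho_three] at this
    rw [map_add, Pi.add_apply, Int.cast_add, ← this, ← rootVec_one_one]
    ring
  have : ((rootVec (iotaCoord y + (1, 1)) i - rootVec (iotaCoord y + (1, 1)) j : ℤ) : ℚ)
      = ((3 * m + (y.right j : ℕ) - (y.right i : ℕ) : ℤ) : ℚ) := by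
    push_cast [e]
    rw [← h.2]
    ring
  exact_mod_cast this

theorem isPosRealRoot_affAct_iff (y : ExtAffWeyl 3) {i j : Fin 3} (hij : i ≠ j) :
    IsPosRealRoot (affAct y (root i j, 0)) ↔
      rootVec (iotaCoord y + (1, 1)) j < rootVec (iotaCoord y + (1, 1)) i := by
  constructor
  · rintro ⟨k, l, m, -, h, hpos⟩
    have := height_affAct hij h
    have := k.isLt
    have := l.isLt
    rw [Fin.lt_def] at hpos
    omega
  · intro h
    obtain ⟨m, hm⟩ := (shift_mem y).2 (y.right j) (y.right i)
    have e : affAct y (root i j, 0) = (root (y.right i) (y.right j), (m : ℚ)) := by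
      rw [affAct_root, hm]
    refine ⟨_, _, m, y.right.injective.ne hij, e, ?_⟩
    have := height_affAct hij e
    have := (y.right i).isLt
    have := (y.right j).isLt
    rw [Fin.lt_def]
    omega

/-- The chamber consists of the `y` for which `ι y + ρ` is strictly dominant. -/
theorem mem_extChamber_iff (y : ExtAffWeyl 3) : y ∈ extChamber 3 ↔
    rootVec (iotaCoord y + (1, 1)) 1 < rootVec (iotaCoord y + (1, 1)) 0 ∧
    rootVec (iotaCoord y + (1, 1)) 2 < rootVec (iotaCoord y + (1, 1)) 1 := by
  rw [← isPosRealRoot_affAct_iff y (by decide : (0 : Fin 3) ≠ 1),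
    ← isPosRealRoot_affAct_iff y (by decide : (1 : Fin 3) ≠ 2)]
  constructor
  · exact fun h => ⟨h 0 1 rfl, h 1 2 rfl⟩
  · rintro ⟨h0, h1⟩ i j hij
    have : (i = 0 ∧ j = 1) ∨ (i = 1 ∧ j = 2) := by
      revert i j
      decide
    rcases this with ⟨rfl, rfl⟩ | ⟨rfl, rfl⟩
    exacts [h0, h1]

theorem rootVec_iotaCoord_mul_ofWeyl (y : ExtAffWeyl 3) (w : Weyl 3) (i : Fin 3) :
    rootVec (iotaCoord (y * ofWeyl w) + (1, 1)) i = rootVec (iotaCoord y + (1, 1)) (w i) := by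
  rw [iotaCoord_mul_ofWeyl, rootVec_coordAct, inv_inv]

theorem rootVec_iotaCoord_injective (y : ExtAffWeyl 3) :
    Function.Injective (rootVec (iotaCoord y + (1, 1))) := by
  have hcls : cls (iotaCoord y + (1, 1)) ≠ 0 := by
    have := cls_iotaCoord_ne_two y
    rw [map_add, cls_rho]
    revert this
    generalize cls (iotaCoord y) = k
    revert k
    decide
  generalize iotaCoord y + (1, 1) = u at hcls ⊢
  obtain ⟨a, b⟩ := u
  have hab : ¬(3 : ℤ) ∣ a + b := by
    rw [← Nat.cast_ofNat, ← ZMod.intCast_zmod_eq_zero_iff_dvd]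
    exact fun h => hcls (neg_eq_zero.2 h)
  intro i j hij
  fin_cases i <;> fin_cases j <;> simp [rootVec] at hij ⊢ <;> omega

/-- Every element of the extended affine Weyl group is carried to the chamber by the Weyl group:
no `ι y + ρ` lies on a wall. -/
theorem exists_mul_ofWeyl_mem_extChamber (y : ExtAffWeyl 3) :
    ∃ w : Weyl 3, y * ofWeyl w ∈ extChamber 3 := by
  set f := rootVec (iotaCoord y + (1, 1)) with hf
  set w := Tuple.sort fun i => -f i with hw
  have hm : Monotone ((fun i => -f i) ∘ w) := Tuple.monotone_sort _
  have hs : ∀ i j, i < j → f (w j) < f (w i) := by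
    intro i j hij
    refine lt_of_le_of_ne (neg_le_neg_iff.1 (hm hij.le)) fun h => hij.ne ?_
    exact (w.injective (rootVec_iotaCoord_injective y h)).symm
  refine ⟨w, (mem_extChamber_iff _).2 ?_⟩
  simp only [rootVec_iotaCoord_mul_ofWeyl]
  exact ⟨hs 0 1 (by decide), hs 1 2 (by decide)⟩

theorem eq_one_of_mul_ofWeyl_mem_extChamber {y : ExtAffWeyl 3} {w : Weyl 3}
    (hy : y ∈ extChamber 3) (hw : y * ofWeyl w ∈ extChamber 3) : w = 1 := by
  rw [mem_extChamber_iff] at hy hw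
  simp only [rootVec_iotaCoord_mul_ofWeyl] at hw
  have hanti : StrictAnti (rootVec (iotaCoord y + (1, 1))) := by
    intro i j hij
    have : (i = 0 ∧ j = 1) ∨ (i = 0 ∧ j = 2) ∨ (i = 1 ∧ j = 2) := by
      revert i j
      decide
    rcases this with ⟨rfl, rfl⟩ | ⟨rfl, rfl⟩ | ⟨rfl, rfl⟩
    exacts [hy.1, hy.2.trans hy.1, hy.2]
  rw [hanti.lt_iff_gt, hanti.lt_iff_gt] at hw
  revert w
  decide

/-- The extended affine Weyl group is tiled by the images of the chamber under the Weyl group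
acting on the right. -/
def chamberEquiv : extChamber 3 × Weyl 3 ≃ ExtAffWeyl 3 :=
  Equiv.ofBijective (fun p => p.1 * ofWeyl p.2) <| by
    constructor
    · rintro ⟨⟨z, hz⟩, w⟩ ⟨⟨z', hz'⟩, w'⟩ h
      change z * ofWeyl w = z' * ofWeyl w' at h
      have e : z' = z * ofWeyl (w * w'⁻¹) := by
        rw [ofWeyl, map_mul, ← mul_assoc, map_inv]
        exact (mul_inv_eq_of_eq_mul h).symm
      have h1 : w * w'⁻¹ = 1 := eq_one_of_mul_ofWeyl_mem_extChamber hz (e ▸ hz')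
      obtain rfl : w = w' := mul_inv_eq_one.1 h1
      obtain rfl : z = z' := mul_right_cancel h
      rfl
    · intro y
      obtain ⟨w, hw⟩ := exists_mul_ofWeyl_mem_extChamber y
      refine ⟨⟨⟨_, hw⟩, w⁻¹⟩, ?_⟩
      change y * ofWeyl w * ofWeyl w⁻¹ = y
      rw [ofWeyl, ofWeyl, map_inv, mul_inv_cancel_right]

theorem chamberEquiv_apply (z : extChamber 3) (w : Weyl 3) :
    chamberEquiv (z, w) = (z : ExtAffWeyl 3) * ofWeyl w := rfl

/-- The diagram automorphisms preserve heights. -/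
theorem iotaCoord_of_mem_diagramGroup {a : ExtAffWeyl 3} (ha : a ∈ diagramGroup 3) :
    iotaCoord a = 0 := by
  have key (i j : Fin 3) (hij : (i : ℕ) + 1 = j) :
      rootVec (iotaCoord a + (1, 1)) i - rootVec (iotaCoord a + (1, 1)) j = 1 := by
    have hne : i ≠ j := by
      rintro rfl
      omega
    have hmem : affAct a (root i j, 0) ∈ affSimpleRoots 3 := by
      change affAct a '' affSimpleRoots 3 = affSimpleRoots 3 at ha
      rw [← ha]
      exact ⟨_, Or.inl ⟨i, j, hij, rfl⟩, rfl⟩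
    rcases hmem with ⟨k, l, hkl, h⟩ | ⟨k, l, hk, hl, h⟩
    · have := height_affAct (m := 0) hne (by rw [h, Int.cast_zero])
      omega
    · have := height_affAct (m := 1) hne (by rw [h, Int.cast_one])
      omega
  have h1 := key 0 1 rfl
  have h2 := key 1 2 rfl
  generalize iotaCoord a = u at h1 h2 ⊢
  obtain ⟨b, c⟩ := u
  simp [rootVec] at h1 h2
  ext <;> simp <;> omega

theorem mem_chamberAt_iff {a : ExtAffWeyl 3} (ha : a ∈ diagramGroup 3) (z : ExtAffWeyl 3) :
    z ∈ chamberAt a ↔ z ∈ extChamber 3 ∧ coset z = coset a := by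
  have hmul (b : ExtAffWeyl 3) (hb : b ∈ diagramGroup 3) (c : ExtAffWeyl 3) :
      b * c ∈ extChamber 3 ↔ c ∈ extChamber 3 := by
    rw [mem_extChamber_iff, mem_extChamber_iff, iotaCoord_mul, iotaCoord_of_mem_diagramGroup hb,
      map_zero, zero_add]
  constructor
  · rintro ⟨c, ⟨hc, hc'⟩, rfl⟩
    refine ⟨(hmul a ha c).2 hc, ?_⟩
    rw [map_mul, (mem_affWeyl_iff c).1 hc', mul_one]
  · rintro ⟨hz, hz'⟩
    refine ⟨a⁻¹ * z, ⟨(hmul _ (inv_mem ha) z).2 hz, ?_⟩, mul_inv_cancel_left a z⟩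
    rw [SetLike.mem_coe, mem_affWeyl_iff, map_mul, hz', map_inv, inv_mul_cancel]

/-! ### Linear independence -/

/-- The weights of the character with dominant highest weight `λ` are at most `λ`; the hypothesis
says that the coordinates of `λ + ρ` decrease. -/
theorem le_of_mult_ne_zero {lam mu : ℤ × ℤ}
    (h : rootVec (lam + (1, 1)) 1 < rootVec (lam + (1, 1)) 0 ∧
      rootVec (lam + (1, 1)) 2 < rootVec (lam + (1, 1)) 1) (hm : mult lam mu ≠ 0) :
    mu.1 ≤ lam.1 ∧ mu.2 ≤ lam.2 := by
  obtain ⟨w, -, hw⟩ := Finset.exists_ne_zero_of_sum_ne_zero hm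
  have := not_imp_comm.1 kp_eq_zero (right_ne_zero_of_mul hw)
  obtain ⟨a, b⟩ := lam
  obtain ⟨c, d⟩ := mu
  simp [rootVec] at h
  rw [Prod.mk_add_mk] at this
  rcases coordAct_cases w with ⟨-, e⟩ | ⟨-, e⟩ | ⟨-, e⟩ | ⟨-, e⟩ | ⟨-, e⟩ | ⟨-, e⟩ <;>
    rw [e] at this <;> simp at this ⊢ <;> omega

theorem mult_self {lam : ℤ × ℤ}
    (h : rootVec (lam + (1, 1)) 1 < rootVec (lam + (1, 1)) 0 ∧
      rootVec (lam + (1, 1)) 2 < rootVec (lam + (1, 1)) 1) : mult lam lam = 1 := by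
  obtain ⟨a, b⟩ := lam
  simp [rootVec] at h
  rw [mult, Prod.mk_add_mk, sum_det_mul_coordAct (fun v => kp (v - (1, 1) - (a, b)))]
  simp only [Prod.mk_sub_mk, kp]
  split_ifs <;> omega

/-- The characters form a triangular family with respect to the height of `ι y`. -/
theorem linearIndependent_chi :
    LinearIndependent ℤ (fun y : extChamber 3 => chi (y : ExtAffWeyl 3)) := by
  rw [linearIndependent_iff']
  intro s c hc
  by_contra! hne
  -- a nonzero coefficient of maximal height `i` survives in the coefficient of `i` in the sum
  have hs : (s.filter fun i => c i ≠ 0).Nonempty := by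
    obtain ⟨i, hi, hi'⟩ := hne
    exact ⟨i, Finset.mem_filter.2 ⟨hi, hi'⟩⟩
  obtain ⟨i, hi, hmax⟩ := Finset.exists_max_image _
    (fun y : extChamber 3 => (iotaCoord (y : ExtAffWeyl 3)).1 + (iotaCoord (y : ExtAffWeyl 3)).2) hs
  rw [Finset.mem_filter] at hi
  have h := congrArg (fun p => MonoidAlgebra.coeff p (i : ExtAffWeyl 3)) hc
  simp only [MonoidAlgebra.coeff_sum, Finsupp.finsetSum_apply, MonoidAlgebra.coeff_smul_apply,
    coeff_chi, MonoidAlgebra.coeff_zero, Finsupp.zero_apply, smul_eq_mul] at h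
  rw [Finset.sum_eq_single_of_mem i hi.1, charMult_eq_mult rfl,
    mult_self ((mem_extChamber_iff _).1 i.2), mul_one] at h
  · exact hi.2 h
  · intro j hj hji
    by_contra hz
    have hcm := right_ne_zero_of_mul hz
    have hco := coset_eq_of_charMult_ne_zero hcm
    rw [charMult_eq_mult hco] at hcm
    have hle := le_of_mult_ne_zero ((mem_extChamber_iff _).1 j.2) hcm
    have hm := hmax j (Finset.mem_filter.2 ⟨hj, left_ne_zero_of_mul hz⟩)
    refine hji (Subtype.ext (eq_of_iotaCoord_eq hco.symm ?_))
    ext <;> omega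

/-! ### The horizontal Kac–Wakimoto groups -/

/-- The reflection in the root `z α` is the conjugate by `z` of the reflection in `α`. -/
theorem affReflection_eq (z : ExtAffWeyl 3) {p q i j : Fin 3} {l : ℤ} (hpq : p ≠ q)
    (h : affAct z (root p q, 0) = (root i j, (l : ℚ))) :
    affReflection i j l = z * ofWeyl (Equiv.swap p q) * z⁻¹ := by
  rw [affAct_root, Prod.mk.injEq] at h
  obtain ⟨rfl, rfl⟩ := root_inj (z.right.injective.ne hpq) h.1
  rw [eq_mul_inv_iff_mul_eq]
  have hr : Equiv.swap (z.right p) (z.right q) * z.right = z.right * Equiv.swap p q :=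
    (Equiv.mul_swap_eq_swap_mul z.right p q).symm
  refine ext_of_shift ?_ hr
  have e1 : shift (affReflection (z.right p) (z.right q) l * z)
      = -(l • root (z.right p) (z.right q)) + act (Equiv.swap (z.right p) (z.right q)) 0
        + act (Equiv.swap (z.right p) (z.right q)) (shift z) := rfl
  have e2 : shift (z * ofWeyl (Equiv.swap p q)) = shift z + act z.right 0 := rfl
  rw [e1, e2]
  funext k
  have hne := z.right.injective.ne hpq
  simp only [act, root, Pi.add_apply, Pi.neg_apply, Pi.smul_apply, Pi.sub_apply, Pi.zero_apply,
    Pi.single_apply, add_zero, Equiv.swap_inv]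
  rw [zsmul_eq_mul, ← h.2]
  by_cases hk : k = z.right p
  · subst hk
    rw [Equiv.swap_apply_left, if_pos rfl, if_neg hne]
    ring
  · by_cases hk' : k = z.right q
    · subst hk'
      rw [Equiv.swap_apply_right, if_pos rfl, if_neg hne.symm]
      ring
    · rw [Equiv.swap_apply_of_ne_of_ne hk hk', if_neg hk, if_neg hk']
      ring

/-- The horizontal Kac–Wakimoto group of `z` is the conjugate by `z` of the Weyl group. -/
theorem coe_kwGroup (z : ExtAffWeyl 3) :
    (kwGroup z : Set (ExtAffWeyl 3)) = Set.range fun w : Weyl 3 => z * ofWeyl w * z⁻¹ := by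
  have hrange : (Set.range fun w : Weyl 3 => z * ofWeyl w * z⁻¹)
      = (((MulAut.conj z).toMonoidHom.comp SemidirectProduct.inr :
        Weyl 3 →* ExtAffWeyl 3).range : Set (ExtAffWeyl 3)) := rfl
  rw [hrange, SetLike.coe_set_eq]
  apply le_antisymm
  · refine (Subgroup.closure_le _).2 ?_
    rintro _ ⟨p, q, hpq, i, j, l, h, rfl⟩
    refine ⟨Equiv.swap p q, (affReflection_eq z ?_ h).symm⟩
    rintro rfl
    omega
  · rintro _ ⟨w, rfl⟩
    have hgen (p q : Fin 3) (hpq : (p : ℕ) + 1 = q) :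
        z * ofWeyl (Equiv.swap p q) * z⁻¹ ∈ kwGroup z := by
      obtain ⟨m, hm⟩ := (shift_mem z).2 (z.right q) (z.right p)
      have e : affAct z (root p q, 0) = (root (z.right p) (z.right q), (m : ℚ)) := by
        rw [affAct_root, hm]
      refine Subgroup.subset_closure ⟨p, q, hpq, _, _, m, e, (affReflection_eq z ?_ e).symm⟩
      rintro rfl
      omega
    induction w using weyl_induction with
    | one => rw [map_one]; exact one_mem _
    | s₁ => exact hgen 0 1 rfl
    | s₂ => exact hgen 1 2 rfl
    | mul u w hu hw => rw [map_mul]; exact mul_mem hu hw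

/-! ### Structure constants -/

/-- The structure constant `N^z_(x,y) = ∑_w det(w) m^x_(z w y⁻¹)`. -/
def structureConst (x y z : ExtAffWeyl 3) : ℤ :=
  ∑ w : Weyl 3, det w * charMult x (z * ofWeyl w * y⁻¹)

theorem exists_of_structureConst_ne_zero {x y z : ExtAffWeyl 3} (h : structureConst x y z ≠ 0) :
    ∃ w : Weyl 3, charMult x (z * ofWeyl w * y⁻¹) ≠ 0 := by
  obtain ⟨w, -, hw⟩ := Finset.exists_ne_zero_of_sum_ne_zero h
  exact ⟨w, right_ne_zero_of_mul hw⟩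

theorem structureConst_support_finite (x y : ExtAffWeyl 3) :
    {z | structureConst x y z ≠ 0}.Finite := by
  refine (((charMult_support_finite x).prod (Set.finite_univ (α := Weyl 3))).image
    fun p => p.1 * y * (ofWeyl p.2)⁻¹).subset fun z hz => ?_
  obtain ⟨w, hw⟩ := exists_of_structureConst_ne_zero hz
  exact ⟨(z * ofWeyl w * y⁻¹, w), ⟨hw, Set.mem_univ _⟩, by simp⟩

theorem coset_of_structureConst_ne_zero {x y z : ExtAffWeyl 3} (h : structureConst x y z ≠ 0) :
    coset z = coset x * coset y := by
  obtain ⟨w, hw⟩ := exists_of_structureConst_ne_zero h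
  rw [← coset_eq_of_charMult_ne_zero hw, map_mul, map_mul, coset_ofWeyl, mul_one, map_inv,
    inv_mul_cancel_right]

theorem chi_mul_chi_eq_finsum (x y : ExtAffWeyl 3) :
    chi x * chi y = ∑ᶠ z : ExtAffWeyl 3, charMult x z • chi (z * y) := by
  rw [chi_mul_chi, finsum_eq_sum_of_support_subset]
  intro z hz
  rw [Set.Finite.coe_toFinset]
  exact fun h => hz (by simp only [h, zero_smul])

/-- The generalised Weyl–Steinberg formula: the terms of the expansion of the product are collected
according to the translates of the chamber. -/
theorem chi_mul_chi_eq_finsum_structureConst (x y : ExtAffWeyl 3) :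
    chi x * chi y = ∑ᶠ z ∈ extChamber 3, structureConst x y z • chi z := by
  rw [chi_mul_chi_eq_finsum, ← finsum_comp_equiv (Equiv.mulRight y⁻¹),
    ← finsum_comp_equiv chamberEquiv, finsum_curry, ← finsum_set_coe_eq_finsum_mem]
  · refine finsum_congr fun z => ?_
    rw [finsum_eq_sum_of_fintype, structureConst, Finset.sum_smul]
    refine Finset.sum_congr rfl fun w _ => ?_
    rw [chamberEquiv_apply, Equiv.coe_mulRight, inv_mul_cancel_right, chi_mul_ofWeyl, smul_smul,
      mul_comm]
  · refine ((charMult_support_finite x).preimage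
      ((Equiv.injective (chamberEquiv.trans (Equiv.mulRight y⁻¹))).injOn)).subset fun p hp => ?_
    exact fun h => hp (by
      change charMult x _ = 0 at h
      change charMult x _ • chi _ = 0
      exact (congrArg (· • _) h).trans (zero_smul _ _))

/-! ### The character ring -/

theorem chi_mem_closure (y : ExtAffWeyl 3) : chi y ∈ AddSubgroup.closure (chi '' extChamber 3) := by
  obtain ⟨⟨z, w⟩, rfl⟩ := chamberEquiv.surjective y
  rw [chamberEquiv_apply, chi_mul_ofWeyl]
  exact zsmul_mem (AddSubgroup.subset_closure (Set.mem_image_of_mem chi z.2)) _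

theorem mul_mem_closure {p q : MonoidAlgebra ℤ (ExtAffWeyl 3)}
    (hp : p ∈ AddSubgroup.closure (chi '' extChamber 3))
    (hq : q ∈ AddSubgroup.closure (chi '' extChamber 3)) :
    p * q ∈ AddSubgroup.closure (chi '' extChamber 3) := by
  induction hp, hq using AddSubgroup.closure_induction₂ with
  | mem p q hp hq =>
    obtain ⟨x, -, rfl⟩ := hp
    obtain ⟨y, -, rfl⟩ := hq
    rw [chi_mul_chi]
    exact sum_mem fun z _ => zsmul_mem (chi_mem_closure _) _
  | zero_left q _ => rw [zero_mul]; exact zero_mem _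
  | zero_right p _ => rw [mul_zero]; exact zero_mem _
  | add_left p q r _ _ _ hp hq => rw [add_mul]; exact add_mem hp hq
  | add_right p q r _ _ _ hp hq => rw [mul_add]; exact add_mem hp hq
  | neg_left p q _ _ h => rw [neg_mul]; exact neg_mem h
  | neg_right p q _ _ h => rw [mul_neg]; exact neg_mem h

theorem subring_closure_toAddSubgroup :
    (Subring.closure (chi '' extChamber 3)).toAddSubgroup
      = AddSubgroup.closure (chi '' extChamber 3) := by
  apply le_antisymm
  · intro p hp
    rw [Subring.mem_toAddSubgroup, Subring.mem_closure_iff] at hp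
    refine (AddSubgroup.closure_le _).2 (fun q hq => ?_) hp
    induction hq using Submonoid.closure_induction with
    | mem q hq => exact AddSubgroup.subset_closure hq
    | one => rw [← chi_one]; exact chi_mem_closure 1
    | mul q r _ _ hq hr => exact mul_mem_closure hq hr
  · exact (AddSubgroup.closure_le _).2 Subring.subset_closure

end

end CharRing


open CharRing
theorem proposition4p5 :
    -- the characters are finite sums, hence elements of the group ring
    (∀ y : ExtAffWeyl 3, {z : ExtAffWeyl 3 | charMult y z ≠ 0}.Finite) ∧
    -- the characters labelled by the dominant chamber are linearly independent
    LinearIndependent ℤ (fun y : extChamber 3 => chi (y : ExtAffWeyl 3)) ∧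
    -- the subring which they generate is commutative
    (∀ f ∈ Subring.closure (chi '' extChamber 3), ∀ g ∈ Subring.closure (chi '' extChamber 3),
      f * g = g * f) ∧
    -- and it is their additive span
    (Subring.closure (chi '' extChamber 3)).toAddSubgroup
      = AddSubgroup.closure (chi '' extChamber 3) ∧
    -- the product of two characters through the generalised weight diagram of the first
    (∀ x ∈ extChamber 3, ∀ y ∈ extChamber 3,
      chi x * chi y = ∑ᶠ z : ExtAffWeyl 3, charMult x z • chi (z * y)) ∧
    -- the structure constants and the generalised Weyl–Steinberg formula
    ∃ N : ExtAffWeyl 3 → ExtAffWeyl 3 → ExtAffWeyl 3 → ℤ,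
      ∀ a ∈ diagramGroup 3, ∀ a' ∈ diagramGroup 3, ∀ x ∈ chamberAt a, ∀ y ∈ chamberAt a',
        {z | z ∈ chamberAt (a * a') ∧ N x y z ≠ 0}.Finite ∧
        chi x * chi y = ∑ᶠ z ∈ chamberAt (a * a'), N x y z • chi z ∧
        ∀ z ∈ chamberAt (a * a'),
          (kwGroup z : Set (ExtAffWeyl 3)).Finite ∧
          N x y z = ∑ᶠ w' ∈ kwGroup z, det w'.right * charMult x (w' * z * y⁻¹) ∧
          N x y z = ∑ w : Weyl 3, det w * charMult x (z * ofWeyl w * y⁻¹) ∧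
          N x y z = ∑ w : Weyl 3, det w * weightMult (iota x) (iota (z * ofWeyl w * y⁻¹)) := by
  refine ⟨charMult_support_finite, linearIndependent_chi, ?_, subring_closure_toAddSubgroup,
    fun x _ y _ => chi_mul_chi_eq_finsum x y, structureConst, ?_⟩
  · intro f hf g hg
    have hcomm : ∀ p ∈ chi '' extChamber 3, ∀ q ∈ chi '' extChamber 3, p * q = q * p := by
      rintro _ ⟨x, -, rfl⟩ _ ⟨y, -, rfl⟩
      exact chi_mul_comm x y
    exact congrArg Subtype.val
      ((Subring.isMulCommutative_closure hcomm).is_comm.comm ⟨f, hf⟩ ⟨g, hg⟩)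
  · intro a ha a' ha' x hx y hy
    obtain ⟨-, hx⟩ := (mem_chamberAt_iff ha x).1 hx
    obtain ⟨-, hy⟩ := (mem_chamberAt_iff ha' y).1 hy
    have hmem := mem_chamberAt_iff (mul_mem ha ha')
    refine ⟨(structureConst_support_finite x y).subset fun z hz => hz.2, ?_, fun z hz => ?_⟩
    · rw [chi_mul_chi_eq_finsum_structureConst]
      refine finsum_mem_inter_support_eq _ _ _ (Set.ext fun z => and_congr_left fun hz => ?_)
      have hN : structureConst x y z ≠ 0 := fun h => hz (by simp only [h, zero_smul])
      rw [hmem, coset_of_structureConst_ne_zero hN, hx, hy, map_mul, and_iff_left rfl]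
    · obtain ⟨-, hz⟩ := (hmem z).1 hz
      refine ⟨?_, ?_, rfl, ?_⟩
      · rw [coe_kwGroup]
        exact Set.finite_range _
      · have hinj : Function.Injective fun w : Weyl 3 => z * ofWeyl w * z⁻¹ := by
          intro u w h
          exact SemidirectProduct.inr_injective (mul_left_cancel (mul_right_cancel h))
        have := finsum_mem_range (f := fun w' : ExtAffWeyl 3 =>
          det w'.right * charMult x (w' * z * y⁻¹)) hinj
        rw [← coe_kwGroup] at this
        refine Eq.trans ?_ this.symm
        rw [finsum_eq_sum_of_fintype]
        refine Finset.sum_congr rfl fun w _ => ?_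
        have hd : det (z * ofWeyl w * z⁻¹).right = det w := by
          change det (z.right * w * z.right⁻¹) = det w
          rw [det_mul, det_mul, det_inv, mul_right_comm, det_mul_self, one_mul]
        rw [hd, inv_mul_cancel_right]
      · refine Finset.sum_congr rfl fun w _ => ?_
        rw [charMult_eq_weightMult]
        rw [map_mul, map_mul, coset_ofWeyl, mul_one, map_inv, hz, map_mul, hx, hy,
          mul_inv_cancel_right]
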